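/- A Sylvester--Gallai configuration is a finite set $S$ of points of the complex projective plane $\mathbb{P}^2(\mathbb{C})\supset\mathbb{C}^2$, not all on one line, such that no line passes through exactly two points of $S$. A Hesse configuration is the image, under a projective automorphism of $\mathbb{P}^2(\mathbb{C})$, of the set of inflection points of the elliptic curve $x^3+y^3+z^3=0$; it has exactly nine points. The only Sylvester--Gallai configuration that can be embedded on four concurrent lines is the Hesse configuration on nine points. That is, a set $S\subset\mathbb{P}^2(\mathbb{C})$ is a Sylvester--Gallai configuration contained in the union of four distinct lines through a common point if and only if $S$ is a Hesse configuration. -/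

import Mathlib

open scoped LinearAlgebra.Projectivization

noncomputable section

namespace SylvesterGallai

/-- The complex projective plane. It contains `ℂ²` through `(x, y) ↦ [x : y : 1]`. -/
abbrev Plane : Type := ℙ ℂ (Fin 3 → ℂ)

/-- The line with dual coordinates `ℓ = [a : b : c]`, that is, the set of the points
`[x : y : z]` with `x * a + y * b + z * c = 0`. Every line of the projective plane is
obtained from exactly one `ℓ`. -/
def line (ℓ : Plane) : Set Plane := {p | Projectivization.orthogonal p ℓ}

/-- All points of `S` lie on one line. -/
def IsCollinear (S : Set Plane) : Prop := ∃ ℓ : Plane, S ⊆ line ℓ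

/-- The line `ℓ` is ordinary for `S`: it passes through exactly two points of `S`. -/
def IsOrdinaryLine (S : Set Plane) (ℓ : Plane) : Prop := (S ∩ line ℓ).ncard = 2

/-- A Sylvester-Gallai configuration: a finite set of points, not all on one line,
that has no ordinary line. -/
structure IsSylvesterGallai (S : Set Plane) : Prop where
  finite : S.Finite
  not_collinear : ¬ IsCollinear S
  no_ordinary : ∀ ℓ : Plane, ¬ IsOrdinaryLine S ℓ

/-- The set `S` lies on `m` concurrent lines: there are `m` distinct lines through one
common point whose union contains `S`. -/
def LiesOnConcurrentLines (m : ℕ) (S : Set Plane) : Prop :=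
  ∃ (c : Plane) (ℓ : Fin m → Plane),
    Function.Injective ℓ ∧ (∀ i, c ∈ line (ℓ i)) ∧ S ⊆ ⋃ i, line (ℓ i)

/-- The Hessian determinant of a polynomial in three variables. -/
def hessian (F : MvPolynomial (Fin 3) ℂ) : MvPolynomial (Fin 3) ℂ :=
  (Matrix.of fun i j : Fin 3 => MvPolynomial.pderiv i (MvPolynomial.pderiv j F)).det

/-- The inflection points of the smooth projective plane curve `F = 0`, for a homogeneous
polynomial `F`: the points of the curve at which the Hessian determinant of `F` vanishes.
(Both conditions do not depend on the choice of homogeneous coordinates.) -/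
def inflectionPoints (F : MvPolynomial (Fin 3) ℂ) : Set Plane :=
  {p | MvPolynomial.eval p.rep F = 0 ∧ MvPolynomial.eval p.rep (hessian F) = 0}

/-- The Fermat cubic `x ^ 3 + y ^ 3 + z ^ 3`, which defines an elliptic curve. -/
def fermatCubic : MvPolynomial (Fin 3) ℂ :=
  MvPolynomial.X 0 ^ 3 + MvPolynomial.X 1 ^ 3 + MvPolynomial.X 2 ^ 3

/-- The nine inflection points of the Fermat cubic. -/
def hessePoints : Set Plane := inflectionPoints fermatCubic

/-- The set `S` is a Hesse configuration: some projective automorphism of the plane maps the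
nine inflection points of the Fermat cubic onto `S`. -/
def IsHesseConfiguration (S : Set Plane) : Prop :=
  ∃ g : (Fin 3 → ℂ) ≃ₗ[ℂ] (Fin 3 → ℂ),
    S = (fun p : Plane => p.map g.toLinearMap g.injective) '' hessePoints

/-- The equations of `hessePoints` in homogeneous coordinates. -/
theorem mk_mem_hessePoints (v : Fin 3 → ℂ) (hv : v ≠ 0) :
    (Projectivization.mk ℂ v hv : Plane) ∈ hessePoints ↔
      v 0 ^ 3 + v 1 ^ 3 + v 2 ^ 3 = 0 ∧ v 0 * v 1 * v 2 = 0 := by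
  obtain ⟨a, ha⟩ := Projectivization.exists_smul_eq_mk_rep ℂ v hv
  have h0 : (a : ℂ) ≠ 0 := a.ne_zero
  have h3 (i : Fin 3) : (Projectivization.mk ℂ v hv).rep i = (a : ℂ) * v i := by
    rw [← ha]; rfl
  have e : (MvPolynomial.eval (Projectivization.mk ℂ v hv).rep) fermatCubic
      = (a : ℂ) ^ 3 * (v 0 ^ 3 + v 1 ^ 3 + v 2 ^ 3) := by
    simp only [fermatCubic, map_add, map_pow, MvPolynomial.eval_X, h3]
    ring
  have e' : (MvPolynomial.eval (Projectivization.mk ℂ v hv).rep) (hessian fermatCubic)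
      = 216 * (a : ℂ) ^ 3 * (v 0 * v 1 * v 2) := by
    have d (i : Fin 3) : MvPolynomial.pderiv i (3 : MvPolynomial (Fin 3) ℂ) = 0 :=
      (MvPolynomial.pderiv i).map_natCast 3
    simp [hessian, fermatCubic, Matrix.det_fin_three, MvPolynomial.pderiv_X, h3, d,
      Derivation.leibniz_pow]
    ring
  simp only [hessePoints, inflectionPoints, Set.mem_ofPred_eq, e, e']
  simp [h0]

end SylvesterGallai

end

/-!
A Sylvester-Gallai configuration `S` on four lines through `c` is pinned down by counting the points
of `S` other than `c` on each of the four lines (`pencilPart`): there are always exactly two.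

*At most two.* Move `c` and one of the lines to infinity, so that the other three become vertical
lines ("columns") `x = a j`, and the points on the line at infinity become slopes. A line of slope
`s` through a point of `S` in one column must meet `S` in another column. Choose an injective
homomorphism from `ℂ` to a linearly ordered group and let `m j` be the top of column `j`. For each
slope `s`, the maximum of `m j - s * a j` over `j` is attained for at least two columns, and
different slopes belong to different pairs of columns. So three slopes are the slopes of the sides
of the triangle of tops (`exists_perm_of_tops`). The same holds for the triangle of bottoms, where
the slopes may be permuted. For each of the six permutations, the equations that the two triangles close up
contradict the inequalities that put each top below, and each bottom above, the opposite side
(`not_three_slopes`).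

*Exactly two.* Two slopes force all columns to be nonempty, since otherwise some column would be
invariant under a nonzero translation (`nonempty_of_two_slopes`). As the four lines are not
ordinary, the only possibility left besides `c ∈ S` with two further points on each line is `c ∉ S` with at most
one point on each line; but a Sylvester-Gallai configuration has more than four points
(`IsSylvesterGallai.four_lt_ncard`, `IsSylvesterGallai.pencil_structure`).

*The nine points.* With two slopes and two points in each column, the lines of either slope pair the
six points along the three pairs of columns. This leaves three parameters `u`, `v`, `w` up to affine
transformations (`exists_column_positions`), and the slopes between the columns make `u`, `v`, `w`
an equilateral triangle (`IsSylvesterGallai.exists_equilateral`). An explicit linear map then sends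
`S` into the Hesse points, and onto them because both sets have nine elements.

Conversely, the Hesse points form a Sylvester-Gallai configuration on four lines through
`[0 : 1 : -1]`, by an explicit third point on every line (`hessePoints_exists_third`), and both
properties are invariant under projective automorphisms.
-/

open scoped Matrix

namespace SylvesterGallai

/-! ### Lines and projective automorphisms -/

theorem mk_mem_line {v w : Fin 3 → ℂ} (hv : v ≠ 0) (hw : w ≠ 0) :
    (Projectivization.mk ℂ v hv : Plane) ∈ line (Projectivization.mk ℂ w hw) ↔ v ⬝ᵥ w = 0 :=
  Iff.rfl

theorem line_eq_of_mem {p q ℓ ℓ' : Plane} (hpq : p ≠ q) (hp : p ∈ line ℓ) (hq : q ∈ line ℓ)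
    (hp' : p ∈ line ℓ') (hq' : q ∈ line ℓ') : ℓ = ℓ' :=
  (Configuration.ofField.eq_or_eq_of_orthogonal hp hq hp' hq').resolve_left hpq

theorem point_eq_of_mem {p q ℓ ℓ' : Plane} (hℓ : ℓ ≠ ℓ') (hp : p ∈ line ℓ) (hq : q ∈ line ℓ)
    (hp' : p ∈ line ℓ') (hq' : q ∈ line ℓ') : p = q :=
  (Configuration.ofField.eq_or_eq_of_orthogonal hp hq hp' hq').resolve_right hℓ

theorem left_mem_line_cross {p q : Plane} (h : p ≠ q) :
    p ∈ line (Projectivization.cross p q) :=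
  Projectivization.orthogonal_cross_left h

theorem right_mem_line_cross {p q : Plane} (h : p ≠ q) :
    q ∈ line (Projectivization.cross p q) :=
  Projectivization.orthogonal_cross_right h

theorem eq_cross_of_mem {p q ℓ : Plane} (h : p ≠ q) (hp : p ∈ line ℓ) (hq : q ∈ line ℓ) :
    ℓ = Projectivization.cross p q :=
  line_eq_of_mem h hp hq (left_mem_line_cross h) (right_mem_line_cross h)

theorem mk_mem_line_cross {u v w : Fin 3 → ℂ} (hu : u ≠ 0) (hv : v ≠ 0) (hw : w ≠ 0)
    (h : Projectivization.mk ℂ v hv ≠ Projectivization.mk ℂ w hw) :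
    (Projectivization.mk ℂ u hu : Plane) ∈
      line (Projectivization.cross (Projectivization.mk ℂ v hv) (Projectivization.mk ℂ w hw)) ↔
    u ⬝ᵥ v ⨯₃ w = 0 := by
  rw [Projectivization.cross_mk_of_ne hv hw h, mk_mem_line]

theorem line_injective : Function.Injective line := by
  intro ℓ ℓ' h
  induction ℓ using Projectivization.ind with | h w hw =>
  induction ℓ' using Projectivization.ind with | h w' hw' =>
  rw [Projectivization.mk_eq_mk_iff_crossProduct_eq_zero]
  by_contra hne
  -- `e ⨯₃ w` is orthogonal to `w`, hence to `w'`, for every vector `e`.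
  have key (e : Fin 3 → ℂ) : e ⬝ᵥ w ⨯₃ w' = 0 := by
    rw [triple_product_permutation, triple_product_permutation, dotProduct_comm]
    by_cases he : e ⨯₃ w = 0
    · simp [he]
    · exact (mk_mem_line he hw').1 (h ▸ (mk_mem_line he hw).2
        (by rw [dotProduct_comm]; exact dot_cross_self e w))
  exact hne (dotProduct_eq_zero _ fun e => by rw [dotProduct_comm]; exact key e)

/-- The absence of ordinary lines, as the existence of a third point of `S` on the line through
two given points. -/
theorem IsSylvesterGallai.exists_third {S : Set Plane} (hS : IsSylvesterGallai S) {p q : Plane}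
    (hp : p ∈ S) (hq : q ∈ S) (hpq : p ≠ q) :
    ∃ r ∈ S, r ≠ p ∧ r ≠ q ∧ r ∈ line (Projectivization.cross p q) := by
  by_contra! h
  refine hS.no_ordinary (Projectivization.cross p q) (Set.ncard_eq_two.2 ⟨p, q, hpq, ?_⟩)
  ext r
  constructor
  · rintro ⟨hr, hrl⟩
    by_contra hr'
    simp only [Set.mem_insert_iff, Set.mem_singleton_iff, not_or] at hr'
    exact h r hr hr'.1 hr'.2 hrl
  · rintro (rfl | rfl)
    · exact ⟨hp, left_mem_line_cross hpq⟩
    · exact ⟨hq, right_mem_line_cross hpq⟩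

theorem isSylvesterGallai_of_exists_third {S : Set Plane} (hfin : S.Finite)
    (hcol : ¬ IsCollinear S)
    (h : ∀ p ∈ S, ∀ q ∈ S, p ≠ q → ∃ r ∈ S, r ≠ p ∧ r ≠ q ∧
      r ∈ line (Projectivization.cross p q)) : IsSylvesterGallai S := by
  refine ⟨hfin, hcol, fun ℓ hℓ => ?_⟩
  obtain ⟨p, q, hpq, he⟩ := Set.ncard_eq_two.1 hℓ
  have hp : p ∈ S ∩ line ℓ := he ▸ by simp
  have hq : q ∈ S ∩ line ℓ := he ▸ by simp
  obtain ⟨r, hr, hrp, hrq, hrl⟩ := h p hp.1 q hq.1 hpq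
  rw [← eq_cross_of_mem hpq hp.2 hq.2] at hrl
  have : r ∈ S ∩ line ℓ := ⟨hr, hrl⟩
  rw [he] at this
  rcases this with h | h
  exacts [hrp h, hrq h]

theorem IsSylvesterGallai.exists_not_mem_line {S : Set Plane} (hS : IsSylvesterGallai S)
    (ℓ : Plane) : ∃ p ∈ S, p ∉ line ℓ := by
  by_contra! h
  exact hS.not_collinear ⟨ℓ, h⟩

/-- A triangle of points of `S` has a further point of `S` on each of two of its sides. -/
theorem IsSylvesterGallai.four_lt_ncard {S : Set Plane} (hS : IsSylvesterGallai S) :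
    4 < S.ncard := by
  classical
  obtain ⟨p, hp, -⟩ := hS.exists_not_mem_line (Projectivization.mk ℂ ![1, 0, 0] (by simp))
  have : ∃ q ∈ S, q ≠ p := by
    by_contra! h
    obtain ⟨w', hw'⟩ : ∃ w', w' ≠ p := by
      by_contra! h'
      have h1 := (h' (Projectivization.mk ℂ ![1, 0, 0] (by simp))).trans
        (h' (Projectivization.mk ℂ ![0, 1, 0] (by simp))).symm
      rw [Projectivization.mk_eq_mk_iff_crossProduct_eq_zero, cross_apply] at h1
      simpa using congrFun h1 2
    obtain ⟨r, hr, hrn⟩ := hS.exists_not_mem_line (Projectivization.cross p w')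
    exact hrn ((h r hr).symm ▸ left_mem_line_cross hw'.symm)
  obtain ⟨q, hq, hqp⟩ := this
  obtain ⟨r, hr, hrl⟩ := hS.exists_not_mem_line (Projectivization.cross p q)
  have hpl := left_mem_line_cross hqp.symm
  have hql := right_mem_line_cross hqp.symm
  have hrp : r ≠ p := fun h => hrl (h ▸ hpl)
  have hrq : r ≠ q := fun h => hrl (h ▸ hql)
  obtain ⟨x, hx, hxp, hxq, hxl⟩ := hS.exists_third hp hq hqp.symm
  obtain ⟨y, hy, hyp, hyr, hyl⟩ := hS.exists_third hp hr hrp.symm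
  have hxr : x ≠ r := fun h => hrl (h ▸ hxl)
  have hpr := left_mem_line_cross hrp.symm
  have hrr := right_mem_line_cross hrp.symm
  have hll : Projectivization.cross p r ≠ Projectivization.cross p q := fun h => hrl (h ▸ hrr)
  have hyq : y ≠ q := by
    rintro rfl
    exact hyp (point_eq_of_mem hll hyl hpr hql hpl)
  have hyx : y ≠ x := by
    rintro rfl
    exact hyp (point_eq_of_mem hll hyl hpr hxl hpl)
  have hsub : (({p, q, r, x, y} : Finset Plane) : Set Plane) ⊆ S := by
    intro z hz
    simp only [Finset.coe_insert, Finset.coe_singleton, Set.mem_insert_iff,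
      Set.mem_singleton_iff] at hz
    rcases hz with rfl | rfl | rfl | rfl | rfl <;> assumption
  have := Set.ncard_le_ncard hsub hS.finite
  rw [Set.ncard_coe_finset] at this
  have hc : ({p, q, r, x, y} : Finset Plane).card = 5 := by
    repeat rw [Finset.card_insert_of_notMem]
    · simp
    all_goals simp [*, hqp.symm, hrp.symm, hrq.symm, hxp.symm, hxq.symm, hxr.symm, hyp.symm,
        hyr.symm, hyq.symm, hyx.symm]
  omega

/-- The projective automorphism of the plane induced by a linear automorphism. -/
noncomputable abbrev automorphism (g : (Fin 3 → ℂ) ≃ₗ[ℂ] (Fin 3 → ℂ)) (p : Plane) : Plane :=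
  p.map g.toLinearMap g.injective

theorem automorphism_injective (g : (Fin 3 → ℂ) ≃ₗ[ℂ] (Fin 3 → ℂ)) :
    Function.Injective (automorphism g) :=
  Projectivization.map_injective _ _

theorem automorphism_symm_apply (g : (Fin 3 → ℂ) ≃ₗ[ℂ] (Fin 3 → ℂ)) (p : Plane) :
    automorphism g.symm (automorphism g p) = p := by
  induction p using Projectivization.ind with | h v hv =>
  simp [automorphism, Projectivization.map_mk]

/-- The preimage of a line under an automorphism is the line given by the transposed matrix. -/
theorem exists_line_preimage (g : (Fin 3 → ℂ) ≃ₗ[ℂ] (Fin 3 → ℂ)) (ℓ : Plane) :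
    ∃ ℓ', ∀ p, automorphism g p ∈ line ℓ ↔ p ∈ line ℓ' := by
  induction ℓ using Projectivization.ind with | h w hw =>
  have key (v : Fin 3 → ℂ) : g v ⬝ᵥ w = v ⬝ᵥ ((LinearMap.toMatrix' g.toLinearMap)ᵀ *ᵥ w) := by
    rw [dotProduct_comm v, Matrix.mulVec_transpose, ← Matrix.dotProduct_mulVec,
      LinearMap.toMatrix'_mulVec, dotProduct_comm]
    rfl
  have hw' : (LinearMap.toMatrix' g.toLinearMap)ᵀ *ᵥ w ≠ 0 := by
    intro h
    refine hw (dotProduct_eq_zero _ fun v => ?_)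
    obtain ⟨u, rfl⟩ := g.surjective v
    rw [dotProduct_comm, key, h, dotProduct_zero]
  refine ⟨Projectivization.mk ℂ _ hw', fun p => ?_⟩
  induction p using Projectivization.ind with | h v hv =>
  rw [automorphism, Projectivization.map_mk, mk_mem_line, mk_mem_line]
  exact (key v) ▸ Iff.rfl

theorem isSylvesterGallai_image {S : Set Plane} (hS : IsSylvesterGallai S)
    (g : (Fin 3 → ℂ) ≃ₗ[ℂ] (Fin 3 → ℂ)) : IsSylvesterGallai (automorphism g '' S) := by
  refine ⟨hS.finite.image _, ?_, fun ℓ => ?_⟩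
  · rintro ⟨ℓ, hℓ⟩
    obtain ⟨ℓ', h'⟩ := exists_line_preimage g ℓ
    exact hS.not_collinear ⟨ℓ', fun p hp => (h' p).1 (hℓ ⟨p, hp, rfl⟩)⟩
  · obtain ⟨ℓ', h'⟩ := exists_line_preimage g ℓ
    have : automorphism g '' S ∩ line ℓ = automorphism g '' (S ∩ line ℓ') := by
      ext p
      constructor
      · rintro ⟨⟨q, hq, rfl⟩, hl⟩
        exact ⟨q, ⟨hq, (h' q).1 hl⟩, rfl⟩
      · rintro ⟨q, ⟨hq, hl⟩, rfl⟩
        exact ⟨⟨q, hq, rfl⟩, (h' q).2 hl⟩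
    rw [IsOrdinaryLine, this, Set.ncard_image_of_injective _ (automorphism_injective g)]
    exact hS.no_ordinary ℓ'

theorem liesOnConcurrentLines_image {m : ℕ} {S : Set Plane} (hS : LiesOnConcurrentLines m S)
    (g : (Fin 3 → ℂ) ≃ₗ[ℂ] (Fin 3 → ℂ)) :
    LiesOnConcurrentLines m (automorphism g '' S) := by
  obtain ⟨c, ℓ, hinj, hc, hsub⟩ := hS
  choose ℓ' h' using fun i => exists_line_preimage g.symm (ℓ i)
  have h'' (i : Fin m) (p : Plane) : automorphism g p ∈ line (ℓ' i) ↔ p ∈ line (ℓ i) := by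
    rw [← h', automorphism_symm_apply]
  refine ⟨automorphism g c, ℓ', fun i j hij => hinj (line_injective ?_), fun i => ?_, ?_⟩
  · ext p
    rw [← h'', hij, h'']
  · exact (h'' i c).2 (hc i)
  · rintro _ ⟨p, hp, rfl⟩
    obtain ⟨i, hi⟩ := Set.mem_iUnion.1 (hsub hp)
    exact Set.mem_iUnion.2 ⟨i, (h'' i p).2 hi⟩

/-! ### The Hesse points -/

/-- The cube roots of unity. -/
def cubeRoots : Set ℂ := {t | t ^ 3 = 1}

theorem exists_cubeRoots_eq :
    ∃ ω : ℂ, ω ^ 2 + ω + 1 = 0 ∧ ω ≠ 1 ∧ ω ^ 2 ≠ 1 ∧ ω ≠ ω ^ 2 ∧ cubeRoots = {1, ω, ω ^ 2} := by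
  have h3 := Complex.isPrimitiveRoot_exp 3 (by norm_num)
  set ω := Complex.exp (2 * Real.pi * Complex.I / (3 : ℕ))
  have h1 : ω ≠ 1 := h3.ne_one (by norm_num)
  have hc : ω ^ 3 = 1 := h3.pow_eq_one
  have hq : ω ^ 2 + ω + 1 = 0 := by
    have : (ω - 1) * (ω ^ 2 + ω + 1) = 0 := by linear_combination hc
    exact (mul_eq_zero.1 this).resolve_left (sub_ne_zero.2 h1)
  refine ⟨ω, hq, h1, fun h => h1 ?_, fun h => h1 ?_, ?_⟩
  · linear_combination hc - ω * h
  · linear_combination hc + (1 + ω) * h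
  · ext t
    simp only [cubeRoots, Set.mem_ofPred_eq, Set.mem_insert_iff, Set.mem_singleton_iff]
    constructor
    · intro h
      have : (t - 1) * ((t - ω) * (t - ω ^ 2)) = 0 := by
        linear_combination h + (-t ^ 2 + ω * t) * hq - hc
      rcases mul_eq_zero.1 this with h | h
      · exact Or.inl (sub_eq_zero.1 h)
      · exact Or.inr ((mul_eq_zero.1 h).imp sub_eq_zero.1 sub_eq_zero.1)
    · rintro (rfl | rfl | rfl)
      · norm_num
      · exact hc
      · linear_combination (ω ^ 3 + 1) * hc

theorem ncard_cubeRoots : cubeRoots.ncard = 3 := by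
  obtain ⟨ω, -, h1, h2, h3, h⟩ := exists_cubeRoots_eq
  rw [h, Set.ncard_eq_three]
  exact ⟨1, ω, ω ^ 2, h1.symm, h2.symm, h3, rfl⟩

theorem finite_cubeRoots : cubeRoots.Finite :=
  Set.finite_of_ncard_ne_zero (by rw [ncard_cubeRoots]; norm_num)

/-- The Hesse points on the line `x = 0`. -/
noncomputable def hessePointX (t : ℂ) : Plane := Projectivization.mk ℂ ![0, 1, -t] (by simp)

/-- The Hesse points on the line `y = 0`. -/
noncomputable def hessePointY (t : ℂ) : Plane := Projectivization.mk ℂ ![-t, 0, 1] (by simp)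

/-- The Hesse points on the line `z = 0`. -/
noncomputable def hessePointZ (t : ℂ) : Plane := Projectivization.mk ℂ ![1, -t, 0] (by simp)

theorem hessePoints_eq :
    hessePoints = hessePointX '' cubeRoots ∪ hessePointY '' cubeRoots ∪
      hessePointZ '' cubeRoots := by
  ext p
  constructor
  · induction p using Projectivization.ind with | h v hv =>
    rw [mk_mem_hessePoints]
    rintro ⟨h3, h0⟩
    have hv' : v 0 ≠ 0 ∨ v 1 ≠ 0 ∨ v 2 ≠ 0 := by
      by_contra! h
      exact hv (funext fun i => by fin_cases i <;> simp [h])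
    rcases mul_eq_zero.1 h0 with h0 | h0
    · rcases mul_eq_zero.1 h0 with h0 | h0
      · rw [h0] at h3 hv'
        have h1 : v 1 ≠ 0 := by grind
        refine Or.inl (Or.inl ⟨-(v 2 / v 1), ?_, ?_⟩)
        · simp only [cubeRoots, Set.mem_ofPred_eq]; field_simp; grind
        · rw [hessePointX, Projectivization.mk_eq_mk_iff_crossProduct_eq_zero, cross_apply]
          ext i; fin_cases i <;> simp [h0] ; field_simp; simp
      · rw [h0] at h3 hv'
        have h1 : v 2 ≠ 0 := by grind
        refine Or.inl (Or.inr ⟨-(v 0 / v 2), ?_, ?_⟩)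
        · simp only [cubeRoots, Set.mem_ofPred_eq]; field_simp; grind
        · rw [hessePointY, Projectivization.mk_eq_mk_iff_crossProduct_eq_zero, cross_apply]
          ext i; fin_cases i <;> simp [h0] ; field_simp; simp
    · rw [h0] at h3 hv'
      have h1 : v 0 ≠ 0 := by grind
      refine Or.inr ⟨-(v 1 / v 0), ?_, ?_⟩
      · simp only [cubeRoots, Set.mem_ofPred_eq]; field_simp; grind
      · rw [hessePointZ, Projectivization.mk_eq_mk_iff_crossProduct_eq_zero, cross_apply]
        ext i; fin_cases i <;> simp [h0] ; field_simp; simp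
  · rintro ((⟨t, ht, rfl⟩ | ⟨t, ht, rfl⟩) | ⟨t, ht, rfl⟩)
    all_goals
      simp only [cubeRoots, Set.mem_ofPred_eq] at ht
      simp only [hessePointX, hessePointY, hessePointZ, mk_mem_hessePoints]
      simp
      linear_combination -ht

theorem hessePointX_injective : Function.Injective hessePointX := by
  intro s t h
  rw [hessePointX, hessePointX, Projectivization.mk_eq_mk_iff_crossProduct_eq_zero,
    cross_apply] at h
  have := congrFun h 0
  simp at this
  linear_combination this

theorem hessePointY_injective : Function.Injective hessePointY := by
  intro s t h
  rw [hessePointY, hessePointY, Projectivization.mk_eq_mk_iff_crossProduct_eq_zero,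
    cross_apply] at h
  have := congrFun h 1
  simp at this
  linear_combination this

theorem hessePointZ_injective : Function.Injective hessePointZ := by
  intro s t h
  rw [hessePointZ, hessePointZ, Projectivization.mk_eq_mk_iff_crossProduct_eq_zero,
    cross_apply] at h
  have := congrFun h 2
  simp at this
  linear_combination this

theorem hessePointX_ne_hessePointY (s t : ℂ) : hessePointX s ≠ hessePointY t := by
  rw [hessePointX, hessePointY, Ne, Projectivization.mk_eq_mk_iff_crossProduct_eq_zero,
    cross_apply]
  intro h
  simpa using congrFun h 0

theorem hessePointX_ne_hessePointZ (s t : ℂ) : hessePointX s ≠ hessePointZ t := by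
  rw [hessePointX, hessePointZ, Ne, Projectivization.mk_eq_mk_iff_crossProduct_eq_zero,
    cross_apply]
  intro h
  simpa using congrFun h 2

theorem hessePointY_ne_hessePointZ (s t : ℂ) : hessePointY s ≠ hessePointZ t := by
  rw [hessePointY, hessePointZ, Ne, Projectivization.mk_eq_mk_iff_crossProduct_eq_zero,
    cross_apply]
  intro h
  simpa using congrFun h 1

theorem finite_hessePoints : hessePoints.Finite := by
  rw [hessePoints_eq]
  exact ((finite_cubeRoots.image _).union (finite_cubeRoots.image _)).union
    (finite_cubeRoots.image _)

theorem ncard_hessePoints : hessePoints.ncard = 9 := by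
  rw [hessePoints_eq, Set.ncard_union_eq _
      ((finite_cubeRoots.image _).union (finite_cubeRoots.image _)) (finite_cubeRoots.image _),
    Set.ncard_union_eq _ (finite_cubeRoots.image _) (finite_cubeRoots.image _),
    Set.ncard_image_of_injective _ hessePointX_injective,
    Set.ncard_image_of_injective _ hessePointY_injective,
    Set.ncard_image_of_injective _ hessePointZ_injective, ncard_cubeRoots]
  · rw [Set.disjoint_left]
    rintro _ ⟨s, -, rfl⟩ ⟨t, -, h⟩
    exact hessePointX_ne_hessePointY _ _ h.symm
  · rw [Set.disjoint_left]
    rintro _ (⟨s, -, rfl⟩ | ⟨s, -, rfl⟩) ⟨t, -, h⟩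
    · exact hessePointX_ne_hessePointZ _ _ h.symm
    · exact hessePointY_ne_hessePointZ _ _ h.symm

theorem exists_third_cubeRoot {s t : ℂ} (h : s ≠ t) :
    ∃ r ∈ cubeRoots, r ≠ s ∧ r ≠ t := by
  have h2 : ({s, t} : Set ℂ).ncard < cubeRoots.ncard := by
    rw [ncard_cubeRoots, Set.ncard_pair h]; norm_num
  obtain ⟨r, hr, hr'⟩ := Set.exists_mem_notMem_of_ncard_lt_ncard h2
  simp only [Set.mem_insert_iff, Set.mem_singleton_iff, not_or] at hr'
  exact ⟨r, hr, hr'⟩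

theorem inv_mul_mem_cubeRoots {s t : ℂ} (hs : s ∈ cubeRoots) (ht : t ∈ cubeRoots) :
    ∃ r ∈ cubeRoots, r * s * t = 1 := by
  simp only [cubeRoots, Set.mem_ofPred_eq] at *
  exact ⟨s ^ 2 * t ^ 2, by linear_combination (s ^ 3 + 1) * t ^ 6 * hs + (t ^ 3 + 1) * ht,
    by linear_combination t ^ 3 * hs + ht⟩

/-- Points on three different sides of the triangle `x y z = 0` are collinear when the product
of their parameters is `1`. -/
theorem collinear_hessePoints {r s t : ℂ} (h : r * s * t = 1) :
    hessePointX r ∈ line (Projectivization.cross (hessePointY s) (hessePointZ t)) ∧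
    hessePointY s ∈ line (Projectivization.cross (hessePointX r) (hessePointZ t)) ∧
    hessePointZ t ∈ line (Projectivization.cross (hessePointX r) (hessePointY s)) := by
  refine ⟨?_, ?_, ?_⟩
  · rw [hessePointX, hessePointY, hessePointZ, mk_mem_line_cross _ _ _
      (hessePointY_ne_hessePointZ s t), cross_apply]
    simp
    linear_combination -h
  · rw [hessePointX, hessePointY, hessePointZ, mk_mem_line_cross _ _ _
      (hessePointX_ne_hessePointZ r t), cross_apply]
    simp
    linear_combination h
  · rw [hessePointX, hessePointY, hessePointZ, mk_mem_line_cross _ _ _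
      (hessePointX_ne_hessePointY r s), cross_apply]
    simp
    linear_combination -h

theorem hessePoints_exists_third {p q : Plane} (hp : p ∈ hessePoints) (hq : q ∈ hessePoints)
    (hpq : p ≠ q) :
    ∃ r ∈ hessePoints, r ≠ p ∧ r ≠ q ∧ r ∈ line (Projectivization.cross p q) := by
  rw [hessePoints_eq] at *
  have same {f : ℂ → Plane} (hf : Function.Injective f) (ℓ : Plane) (hℓ : ∀ t, f t ∈ line ℓ)
      {s t : ℂ} (hst : f s ≠ f t) :
      ∃ r ∈ f '' cubeRoots, r ≠ f s ∧ r ≠ f t ∧ r ∈ line (Projectivization.cross (f s) (f t)) := by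
    obtain ⟨r, hr, hrs, hrt⟩ := exists_third_cubeRoot (s := s) (t := t) fun h => hst (h ▸ rfl)
    exact ⟨f r, ⟨r, hr, rfl⟩, hf.ne hrs, hf.ne hrt,
      eq_cross_of_mem hst (hℓ s) (hℓ t) ▸ hℓ r⟩
  rcases hp with (⟨s, hs, rfl⟩ | ⟨s, hs, rfl⟩) | ⟨s, hs, rfl⟩ <;>
  rcases hq with (⟨t, ht, rfl⟩ | ⟨t, ht, rfl⟩) | ⟨t, ht, rfl⟩
  · obtain ⟨r, hr, h⟩ := same hessePointX_injective
      (Projectivization.mk ℂ ![1, 0, 0] (by simp)) (fun t => by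
        rw [hessePointX, mk_mem_line]; simp) hpq
    exact ⟨r, Or.inl (Or.inl hr), h⟩
  · obtain ⟨r, hr, h⟩ := inv_mul_mem_cubeRoots hs ht
    exact ⟨hessePointZ r, Or.inr ⟨r, hr, rfl⟩, (hessePointX_ne_hessePointZ _ _).symm,
      (hessePointY_ne_hessePointZ _ _).symm,
      (collinear_hessePoints (show s * t * r = 1 by linear_combination h)).2.2⟩
  · obtain ⟨r, hr, h⟩ := inv_mul_mem_cubeRoots hs ht
    exact ⟨hessePointY r, Or.inl (Or.inr ⟨r, hr, rfl⟩), (hessePointX_ne_hessePointY _ _).symm,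
      hessePointY_ne_hessePointZ _ _,
      (collinear_hessePoints (show s * r * t = 1 by linear_combination h)).2.1⟩
  · obtain ⟨r, hr, h⟩ := inv_mul_mem_cubeRoots hs ht
    refine ⟨hessePointZ r, Or.inr ⟨r, hr, rfl⟩, (hessePointY_ne_hessePointZ _ _).symm,
      (hessePointX_ne_hessePointZ _ _).symm, ?_⟩
    rw [Projectivization.cross_comm]
    exact (collinear_hessePoints (show t * s * r = 1 by linear_combination h)).2.2
  · obtain ⟨r, hr, h⟩ := same hessePointY_injective
      (Projectivization.mk ℂ ![0, 1, 0] (by simp)) (fun t => by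
        rw [hessePointY, mk_mem_line]; simp) hpq
    exact ⟨r, Or.inl (Or.inr hr), h⟩
  · obtain ⟨r, hr, h⟩ := inv_mul_mem_cubeRoots hs ht
    exact ⟨hessePointX r, Or.inl (Or.inl ⟨r, hr, rfl⟩), hessePointX_ne_hessePointY _ _,
      hessePointX_ne_hessePointZ _ _, (collinear_hessePoints h).1⟩
  · obtain ⟨r, hr, h⟩ := inv_mul_mem_cubeRoots hs ht
    refine ⟨hessePointY r, Or.inl (Or.inr ⟨r, hr, rfl⟩), hessePointY_ne_hessePointZ _ _,
      (hessePointX_ne_hessePointY _ _).symm, ?_⟩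
    rw [Projectivization.cross_comm]
    exact (collinear_hessePoints (show t * r * s = 1 by linear_combination h)).2.1
  · obtain ⟨r, hr, h⟩ := inv_mul_mem_cubeRoots hs ht
    refine ⟨hessePointX r, Or.inl (Or.inl ⟨r, hr, rfl⟩), hessePointX_ne_hessePointZ _ _,
      hessePointX_ne_hessePointY _ _, ?_⟩
    rw [Projectivization.cross_comm]
    exact (collinear_hessePoints (show r * t * s = 1 by linear_combination h)).1
  · obtain ⟨r, hr, h⟩ := same hessePointZ_injective
      (Projectivization.mk ℂ ![0, 0, 1] (by simp)) (fun t => by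
        rw [hessePointZ, mk_mem_line]; simp) hpq
    exact ⟨r, Or.inr hr, h⟩

theorem isSylvesterGallai_hessePoints : IsSylvesterGallai hessePoints := by
  refine isSylvesterGallai_of_exists_third finite_hessePoints ?_
    fun p hp q hq hpq => hessePoints_exists_third hp hq hpq
  rintro ⟨ℓ, hℓ⟩
  induction ℓ using Projectivization.ind with | h w hw =>
  obtain ⟨ω, -, h1, -, -, hR⟩ := exists_cubeRoots_eq
  have hX {t : ℂ} (ht : t ∈ cubeRoots) : w 1 - t * w 2 = 0 := by
    have := @hℓ (hessePointX t) (by rw [hessePoints_eq]; exact Or.inl (Or.inl ⟨t, ht, rfl⟩))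
    rw [hessePointX, mk_mem_line, Matrix.vec3_dotProduct] at this
    simpa [Matrix.vec3_dotProduct, sub_eq_add_neg] using this
  have hZ : w 0 - w 1 = 0 := by
    have := @hℓ (hessePointZ 1) (by
      rw [hessePoints_eq]; exact Or.inr ⟨1, by simp [hR], rfl⟩)
    rw [hessePointZ, mk_mem_line, Matrix.vec3_dotProduct] at this
    simpa [Matrix.vec3_dotProduct, sub_eq_add_neg] using this
  have ha := hX (t := 1) (by simp [hR])
  have hb := hX (t := ω) (by simp [hR])
  have h2 : w 2 = 0 := by
    have : (ω - 1) * w 2 = 0 := by linear_combination ha - hb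
    exact (mul_eq_zero.1 this).resolve_left (sub_ne_zero.2 h1)
  have h1 : w 1 = 0 := by linear_combination ha + h2
  have h0 : w 0 = 0 := by linear_combination hZ + h1
  exact hw (funext fun i => by fin_cases i <;> simp [h0, h1, h2])

/-- The four lines through the Hesse point `[0 : 1 : -1]` contain all the Hesse points. -/
theorem liesOnConcurrentLines_hessePoints : LiesOnConcurrentLines 4 hessePoints := by
  obtain ⟨ω, -, h1, h2, h3, hR⟩ := exists_cubeRoots_eq
  let L (t : ℂ) : Plane := Projectivization.mk ℂ ![t, 1, 1] (by simp)
  have hL : Function.Injective L := by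
    intro s t h
    rw [Projectivization.mk_eq_mk_iff_crossProduct_eq_zero, cross_apply] at h
    have := congrFun h 1
    simp at this
    linear_combination -this
  have hL' (t : ℂ) : Projectivization.mk ℂ ![1, 0, 0] (by simp) ≠ L t := by
    rw [Ne, Projectivization.mk_eq_mk_iff_crossProduct_eq_zero, cross_apply]
    intro h
    simpa using congrFun h 2
  have hX (t : ℂ) : hessePointX t ∈ line (Projectivization.mk ℂ ![1, 0, 0] (by simp)) := by
    rw [hessePointX, mk_mem_line]; simp
  have hYZ {t : ℂ} (ht : t ∈ cubeRoots) (p : Plane)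
      (hp : p ∈ line (L t)) : p ∈ ⋃ i, line
        ((![Projectivization.mk ℂ ![1, 0, 0] (by simp), L 1, L ω, L (ω ^ 2)] : Fin 4 → Plane) i) := by
    rw [hR] at ht
    rw [Set.mem_iUnion]
    rcases ht with rfl | rfl | rfl
    exacts [⟨1, hp⟩, ⟨2, hp⟩, ⟨3, hp⟩]
  refine ⟨hessePointX 1, ![Projectivization.mk ℂ ![1, 0, 0] (by simp), L 1, L ω, L (ω ^ 2)],
    ?_, fun i => ?_, ?_⟩
  · intro i j hij
    fin_cases i <;> fin_cases j <;>
      simp [hL', (hL' _).symm, hL.eq_iff, h1, h2, h3, h1.symm, h2.symm, h3.symm] at hij ⊢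
  · have (t : ℂ) : hessePointX 1 ∈ line (L t) := by
      rw [hessePointX, mk_mem_line]; simp
    fin_cases i
    exacts [hX 1, this _, this _, this _]
  · intro p hp
    rw [hessePoints_eq] at hp
    rcases hp with (⟨t, ht, rfl⟩ | ⟨t, ht, rfl⟩) | ⟨t, ht, rfl⟩
    · exact Set.mem_iUnion.2 ⟨0, hX t⟩
    · have ht' : t ^ 3 = 1 := ht
      refine hYZ (t := t ^ 2) ?_ _ ?_
      · change (t ^ 2) ^ 3 = 1
        linear_combination (t ^ 3 + 1) * ht'
      · rw [hessePointY, mk_mem_line]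
        simp
        linear_combination -ht'
    · refine hYZ ht _ ?_
      rw [hessePointZ, mk_mem_line]
      simp

/-! ### Slopes and columns -/

/-- A function on three elements without a strict maximum is maximal off a single element. -/
theorem exists_eq_off_of_forall_exists_le {G : Type*} [LinearOrder G] (f : Fin 3 → G)
    (h : ∀ j, ∃ k, k ≠ j ∧ f j ≤ f k) : ∃ l, ∀ j, j ≠ l → ∀ k, f k ≤ f j := by
  obtain ⟨j₀, hj₀⟩ := Finite.exists_max f
  obtain ⟨k₀, hne, hk₀⟩ := h j₀
  obtain ⟨l, hl⟩ : ∃ l : Fin 3, ∀ j, j ≠ l → j = j₀ ∨ j = k₀ := by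
    revert hne; clear hk₀ hj₀; revert j₀ k₀; decide
  refine ⟨l, fun j hj k => ?_⟩
  rcases hl j hj with rfl | rfl
  · exact hj₀ k
  · exact (hj₀ k).trans hk₀

/-- Each of the three slopes `s i` joins the tops of exactly two of the three columns, and
different slopes join different pairs. Here `π l` is the index of the slope of the side opposite
to column `l` in the triangle of tops; the equation says that the sides of the triangle close up,
the inequality that the top of column `l` lies below the opposite side. -/
theorem exists_perm_of_tops {G : Type*} [AddCommGroup G] [LinearOrder G] [IsOrderedAddMonoid G]
    (φ : ℂ →+ G) (hφ : Function.Injective φ) {A : Fin 3 → Set ℂ} {a s : Fin 3 → ℂ}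
    (ha : Function.Injective a) (hs : Function.Injective s) (hfin : ∀ j, (A j).Finite)
    (hne : ∀ j, (A j).Nonempty)
    (h : ∀ i j, ∀ y ∈ A j, ∃ k, k ≠ j ∧ y + s i * (a k - a j) ∈ A k) :
    ∃ π : Equiv.Perm (Fin 3),
      s (π 0) * (a 1 - a 2) + s (π 1) * (a 2 - a 0) + s (π 2) * (a 0 - a 1) = 0 ∧
      ∀ j k l, j ≠ k → k ≠ l → j ≠ l → 0 < φ ((s (π k) - s (π l)) * (a j - a l)) := by
  choose m hm hmax using fun j => (hfin j).exists_maximalFor φ (A j) (hne j)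
  have hmax' (j : Fin 3) {y : ℂ} (hy : y ∈ A j) : φ y ≤ φ (m j) :=
    le_of_not_gt fun hlt => (hlt.trans_le (hmax j hy hlt.le)).false
  -- `o i` is the column opposite to the pair of columns joined along slope `s i`.
  choose o ho using fun i => exists_eq_off_of_forall_exists_le (fun j => φ (m j - s i * a j))
    (fun j => by
      obtain ⟨k, hkj, hk⟩ := h i j (m j) (hm j)
      refine ⟨k, hkj, ?_⟩
      have := sub_le_sub_right (hmax' k hk) (φ (s i * a k))
      rw [← map_sub, ← map_sub] at this
      convert this using 2
      ring)
  have heq {i j k : Fin 3} (hj : j ≠ o i) (hk : k ≠ o i) : m j - m k = s i * (a j - a k) := by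
    linear_combination hφ (le_antisymm (ho i k hk j) (ho i j hj k))
  have hinj : Function.Injective o := by
    intro i i' hii
    obtain ⟨j, k, hjk, hj, hk⟩ : ∃ j k : Fin 3, j ≠ k ∧ j ≠ o i ∧ k ≠ o i := by
      generalize o i = l; revert l; decide
    have e := heq hj hk
    rw [heq (hii ▸ hj) (hii ▸ hk)] at e
    exact (hs (mul_right_cancel₀ (sub_ne_zero.2 (ha.ne hjk)) e)).symm
  let σ := Equiv.ofBijective o (Finite.injective_iff_bijective.1 hinj)
  have hσ (l : Fin 3) : o (σ.symm l) = l := σ.apply_symm_apply l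
  have heq' (l : Fin 3) {j k : Fin 3} (hj : j ≠ l) (hk : k ≠ l) :
      m j - m k = s (σ.symm l) * (a j - a k) := heq (by rwa [hσ]) (by rwa [hσ])
  refine ⟨σ.symm, ?_, fun j k l hjk hkl hjl => ?_⟩
  · rw [← heq' 0 (by decide) (by decide), ← heq' 1 (by decide) (by decide),
      ← heq' 2 (by decide) (by decide)]
    ring
  · refine lt_of_le_of_ne ?_ ?_
    · have := ho (σ.symm l) j (by rwa [hσ]) l
      rw [← sub_nonneg, ← map_sub] at this
      convert this using 2
      linear_combination -heq' k hjk hkl.symm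
    · rw [← map_zero φ]
      refine hφ.ne (mul_ne_zero ?_ (sub_ne_zero.2 (ha.ne hjl))).symm
      exact sub_ne_zero.2 ((hs.comp σ.symm.injective).ne hkl)

/-- Real and imaginary part, ordered lexicographically: an injection of the additive group `ℂ`
into a linearly ordered group. -/
def toLexHom : ℂ →+ ℝ ×ₗ ℝ where
  toFun z := toLex (z.re, z.im)
  map_zero' := rfl
  map_add' _ _ := rfl

theorem toLexHom_injective : Function.Injective toLexHom := by
  intro z w h
  have := toLex.injective h
  simp only [Prod.mk.injEq] at this
  exact Complex.ext this.1 this.2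

/-- Three columns and three slopes do not suffice: the triangle of the highest points and that
of the lowest points would have sides of the same three slopes. -/
theorem not_three_slopes {A : Fin 3 → Set ℂ} {a s : Fin 3 → ℂ}
    (ha : Function.Injective a) (hs : Function.Injective s) (hfin : ∀ j, (A j).Finite)
    (hne : ∀ j, (A j).Nonempty)
    (h : ∀ i j, ∀ y ∈ A j, ∃ k, k ≠ j ∧ y + s i * (a k - a j) ∈ A k) : False := by
  obtain ⟨π, hI, hP⟩ := exists_perm_of_tops toLexHom toLexHom_injective ha hs hfin hne h
  obtain ⟨π', hI', hP'⟩ := exists_perm_of_tops (-toLexHom)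
    (fun z w hzw => toLexHom_injective (neg_injective hzw)) ha hs hfin hne h
  set φ := toLexHom
  obtain ⟨t, ht⟩ : ∃ t : Fin 3 → ℂ, t = s ∘ π := ⟨_, rfl⟩
  obtain ⟨τ, hτ⟩ : ∃ τ : Equiv.Perm (Fin 3), τ = π'.trans π.symm := ⟨_, rfl⟩
  have e (l : Fin 3) : s (π l) = t l := by rw [ht]; rfl
  have e' (l : Fin 3) : s (π' l) = t (τ l) := by simp [ht, hτ]
  have htinj : Function.Injective t := ht ▸ hs.comp π.injective
  simp only [e] at hI hP
  simp only [e'] at hI' hP'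
  have sub_ne {i j : Fin 3} (hij : i ≠ j) : t i - t j ≠ 0 := sub_ne_zero.2 (htinj.ne hij)
  -- A transposition of the slopes forces one column to be the midpoint of the two others.
  have mid {j k l : Fin 3} (hjk : j ≠ k) (hkl : k ≠ l) (hjl : j ≠ l)
      (hm : (a j - a l) - (a l - a k) = 0) : False := by
    have h1 := hP j k l hjk hkl hjl
    have h2 := hP j l k hjl hkl.symm hjk
    have : (t l - t k) * (a j - a k) =
        -((t k - t l) * (a j - a l) + (t k - t l) * (a j - a l)) := by
      linear_combination (t k - t l) * hm
    rw [this, map_neg, map_add] at h2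
    exact (neg_pos.1 h2).not_gt (add_pos h1 h1)
  -- A 3-cycle makes three positive values add up to zero.
  have cyc (hm : t 0 * (a 0 + a 2 - 2 * a 1) + t 1 * (a 0 + a 1 - 2 * a 2)
      + t 2 * (a 1 + a 2 - 2 * a 0) = 0) : False := by
    have h1 := add_pos (add_pos (hP 0 1 2 (by decide) (by decide) (by decide))
      (hP 1 2 0 (by decide) (by decide) (by decide)))
      (hP 2 0 1 (by decide) (by decide) (by decide))
    rw [← map_add, ← map_add] at h1
    have : (t 1 - t 2) * (a 0 - a 2) + (t 2 - t 0) * (a 1 - a 0) +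
        (t 0 - t 1) * (a 2 - a 1) = 0 := by
      linear_combination hm
    rw [this, map_zero] at h1
    exact h1.false
  have cases : ∀ τ : Equiv.Perm (Fin 3),
      (τ 0 = 0 ∧ τ 1 = 1 ∧ τ 2 = 2) ∨ (τ 0 = 1 ∧ τ 1 = 0 ∧ τ 2 = 2) ∨
      (τ 0 = 2 ∧ τ 1 = 1 ∧ τ 2 = 0) ∨ (τ 0 = 0 ∧ τ 1 = 2 ∧ τ 2 = 1) ∨
      (τ 0 = 1 ∧ τ 1 = 2 ∧ τ 2 = 0) ∨ (τ 0 = 2 ∧ τ 1 = 0 ∧ τ 2 = 1) := by decide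
  rcases cases τ with ⟨h0, h1, h2⟩ | ⟨h0, h1, h2⟩ | ⟨h0, h1, h2⟩ | ⟨h0, h1, h2⟩ | ⟨h0, h1, h2⟩ |
    ⟨h0, h1, h2⟩ <;> rw [h0, h1, h2] at hI'
  · have p1 := hP 0 1 2 (by decide) (by decide) (by decide)
    have p2 := hP' 0 1 2 (by decide) (by decide) (by decide)
    rw [h1, h2, AddMonoidHom.neg_apply] at p2
    exact (neg_pos.1 p2).not_gt p1
  · refine mid (j := 0) (k := 1) (l := 2) (by decide) (by decide) (by decide) ?_
    refine (mul_eq_zero.1 (?_ : (t 0 - t 1) * _ = 0)).resolve_left (sub_ne (by decide))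
    linear_combination hI - hI'
  · refine mid (j := 0) (k := 2) (l := 1) (by decide) (by decide) (by decide) ?_
    refine (mul_eq_zero.1 (?_ : (t 0 - t 2) * _ = 0)).resolve_left (sub_ne (by decide))
    linear_combination hI' - hI
  · refine mid (j := 1) (k := 2) (l := 0) (by decide) (by decide) (by decide) ?_
    refine (mul_eq_zero.1 (?_ : (t 1 - t 2) * _ = 0)).resolve_left (sub_ne (by decide))
    linear_combination hI - hI'
  · exact cyc (by linear_combination hI' - hI)
  · exact cyc (by linear_combination -2 * hI - hI')

/-- Two slopes need all three columns: alternating between two columns along the two slopes is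
a translation of each column, of infinite order. -/
theorem nonempty_of_two_slopes {A : Fin 3 → Set ℂ} {a : Fin 3 → ℂ} {s s' : ℂ}
    (ha : Function.Injective a) (hs : s ≠ s') (hfin : ∀ j, (A j).Finite)
    (hne : ∃ j, (A j).Nonempty)
    (h : ∀ j, ∀ y ∈ A j, ∃ k, k ≠ j ∧ y + s * (a k - a j) ∈ A k)
    (h' : ∀ j, ∀ y ∈ A j, ∃ k, k ≠ j ∧ y + s' * (a k - a j) ∈ A k) (j : Fin 3) :
    (A j).Nonempty := by
  by_contra hj
  rw [Set.not_nonempty_iff_eq_empty] at hj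
  obtain ⟨k, y₀, hy₀⟩ := hne
  have hkj : k ≠ j := by rintro rfl; simp [hj] at hy₀
  obtain ⟨l, hlk, hl⟩ : ∃ l : Fin 3, l ≠ k ∧ ∀ i, i ≠ j → (i ≠ k ↔ i = l) := by
    clear hj hy₀; revert j k; decide
  have hlj : l ≠ j := by
    rintro rfl
    obtain ⟨i, hi, hi'⟩ := h k y₀ hy₀
    have hij : i ≠ l := by rintro rfl; simp [hj] at hi'
    exact hij ((hl i hij).1 hi)
  have step {y : ℂ} (hy : y ∈ A k) : y + (s - s') * (a l - a k) ∈ A k := by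
    obtain ⟨i, hi, hy1⟩ := h k y hy
    have hij : i ≠ j := by rintro rfl; simp [hj] at hy1
    obtain rfl := (hl i hij).1 hi
    obtain ⟨i', hi', hy2⟩ := h' i _ hy1
    have hij' : i' ≠ j := by rintro rfl; simp [hj] at hy2
    have : i' = k := by
      by_contra hne
      exact hi' ((hl i' hij').1 hne)
    rw [this] at hy2
    convert hy2 using 1
    ring
  have hd : (s - s') * (a l - a k) ≠ 0 :=
    mul_ne_zero (sub_ne_zero.2 hs) (sub_ne_zero.2 (ha.ne hlk))
  have hn (n : ℕ) : y₀ + n * ((s - s') * (a l - a k)) ∈ A k := by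
    induction n with
    | zero => simpa using hy₀
    | succ n ih =>
      convert step ih using 1
      push_cast; ring
  refine Set.infinite_of_injective_forall_mem (fun n n' hnn => ?_) hn (hfin k)
  have := mul_right_cancel₀ hd (add_left_cancel hnn)
  exact_mod_cast this

/-! ### Four concurrent lines -/

/-- The point at infinity of the vertical lines of the affine plane `z = 1`. -/
noncomputable def verticalPoint : Plane := Projectivization.mk ℂ ![0, 1, 0] (by simp)

/-- The point at infinity of the lines of slope `s`. -/
noncomputable def slopePoint (s : ℂ) : Plane := Projectivization.mk ℂ ![1, s, 0] (by simp)

/-- The point `(x, y)` of the affine plane `z = 1`. -/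
noncomputable def affinePoint (x y : ℂ) : Plane := Projectivization.mk ℂ ![x, y, 1] (by simp)

/-- The line at infinity followed by the three vertical lines `x = a j`: four lines through
`verticalPoint`. -/
noncomputable def columnLines (a : Fin 3 → ℂ) : Fin 4 → Plane :=
  Fin.cons (Projectivization.mk ℂ ![0, 0, 1] (by simp))
    fun j => Projectivization.mk ℂ ![1, 0, -a j] (by simp)

theorem slopePoint_ne_verticalPoint (s : ℂ) : slopePoint s ≠ verticalPoint := by
  rw [slopePoint, verticalPoint, Ne, Projectivization.mk_eq_mk_iff_crossProduct_eq_zero,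
    cross_apply]
  intro h
  simpa using congrFun h 2

theorem affinePoint_ne_verticalPoint (x y : ℂ) : affinePoint x y ≠ verticalPoint := by
  rw [affinePoint, verticalPoint, Ne, Projectivization.mk_eq_mk_iff_crossProduct_eq_zero,
    cross_apply]
  intro h
  simpa using congrFun h 0

theorem slopePoint_ne_affinePoint (s x y : ℂ) : slopePoint s ≠ affinePoint x y := by
  rw [slopePoint, affinePoint, Ne, Projectivization.mk_eq_mk_iff_crossProduct_eq_zero,
    cross_apply]
  intro h
  simpa using congrFun h 1

theorem slopePoint_injective : Function.Injective slopePoint := by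
  intro s t h
  rw [slopePoint, slopePoint, Projectivization.mk_eq_mk_iff_crossProduct_eq_zero,
    cross_apply] at h
  have := congrFun h 2
  simp at this
  linear_combination -this

theorem affinePoint_inj {x y x' y' : ℂ} :
    affinePoint x y = affinePoint x' y' ↔ x = x' ∧ y = y' := by
  refine ⟨fun h => ?_, by rintro ⟨rfl, rfl⟩; rfl⟩
  rw [affinePoint, affinePoint, Projectivization.mk_eq_mk_iff_crossProduct_eq_zero,
    cross_apply] at h
  have h0 := congrFun h 0
  have h1 := congrFun h 1
  simp at h0 h1
  exact ⟨by linear_combination -h1, by linear_combination h0⟩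

theorem slopePoint_mem_columnLines (a : Fin 3 → ℂ) (s : ℂ) :
    slopePoint s ∈ line (columnLines a 0) := by
  change ![1, s, 0] ⬝ᵥ ![0, 0, 1] = 0
  simp

theorem affinePoint_mem_columnLines (a : Fin 3 → ℂ) (j : Fin 3) (y : ℂ) :
    affinePoint (a j) y ∈ line (columnLines a j.succ) := by
  change ![a j, y, 1] ⬝ᵥ ![1, 0, -a j] = 0
  simp

theorem eq_of_mem_columnLines_zero {a : Fin 3 → ℂ} {p : Plane}
    (hp : p ∈ line (columnLines a 0)) : p = verticalPoint ∨ ∃ s, p = slopePoint s := by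
  induction p using Projectivization.ind with | h v hv =>
  have h2 : v 2 = 0 := by
    have : v ⬝ᵥ ![0, 0, 1] = 0 := hp
    rw [Matrix.vec3_dotProduct] at this
    simpa using this
  by_cases h0 : v 0 = 0
  · left
    rw [verticalPoint, Projectivization.mk_eq_mk_iff_crossProduct_eq_zero, cross_apply]
    simp [h0, h2]
  · right
    refine ⟨v 1 / v 0, ?_⟩
    rw [slopePoint, Projectivization.mk_eq_mk_iff_crossProduct_eq_zero, cross_apply]
    ext i; fin_cases i <;> simp [h2]
    field_simp; simp

theorem eq_of_mem_columnLines_succ {a : Fin 3 → ℂ} {j : Fin 3} {p : Plane}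
    (hp : p ∈ line (columnLines a j.succ)) :
    p = verticalPoint ∨ ∃ y, p = affinePoint (a j) y := by
  induction p using Projectivization.ind with | h v hv =>
  have h0 : v 0 = a j * v 2 := by
    have : v ⬝ᵥ ![1, 0, -a j] = 0 := hp
    rw [Matrix.vec3_dotProduct] at this
    simp at this
    linear_combination this
  by_cases h2 : v 2 = 0
  · left
    rw [verticalPoint, Projectivization.mk_eq_mk_iff_crossProduct_eq_zero, cross_apply]
    simp [h0, h2]
  · right
    refine ⟨v 1 / v 2, ?_⟩
    rw [affinePoint, Projectivization.mk_eq_mk_iff_crossProduct_eq_zero, cross_apply]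
    ext i; fin_cases i <;> simp [h0] <;> field_simp <;> ring

/-- Four lines through `c` can be moved to the line at infinity and three vertical lines. -/
theorem exists_automorphism_columnLines {c : Plane} {ℓ : Fin 4 → Plane}
    (hℓ : Function.Injective ℓ) (hc : ∀ i, c ∈ line (ℓ i)) :
    ∃ (g : (Fin 3 → ℂ) ≃ₗ[ℂ] (Fin 3 → ℂ)) (a : Fin 3 → ℂ), Function.Injective a ∧
      automorphism g c = verticalPoint ∧
      ∀ i p, automorphism g p ∈ line (columnLines a i) ↔ p ∈ line (ℓ i) := by
  obtain ⟨w, hw, hw0⟩ : ∃ (w : Fin 3 → ℂ) (hw : w ≠ 0), ℓ 0 = Projectivization.mk ℂ w hw :=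
    ⟨_, _, (Projectivization.mk_rep _).symm⟩
  obtain ⟨w', hw', hw1⟩ : ∃ (w : Fin 3 → ℂ) (hw : w ≠ 0), ℓ 1 = Projectivization.mk ℂ w hw :=
    ⟨_, _, (Projectivization.mk_rep _).symm⟩
  obtain ⟨u, hu, huc⟩ : ∃ (u : Fin 3 → ℂ) (hu : u ≠ 0), c = Projectivization.mk ℂ u hu :=
    ⟨_, _, (Projectivization.mk_rep _).symm⟩
  obtain ⟨i₀, hi₀⟩ : ∃ i, u i ≠ 0 := Function.ne_iff.1 hu
  have huw : u ⬝ᵥ w = 0 := by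
    have := hc 0
    rwa [huc, hw0, mk_mem_line] at this
  have huw' : u ⬝ᵥ w' = 0 := by
    have := hc 1
    rwa [huc, hw1, mk_mem_line] at this
  -- The last coordinate vanishes on `ℓ 0`, the first on `ℓ 1`, and the middle one not at `c`.
  let f : (Fin 3 → ℂ) →ₗ[ℂ] (Fin 3 → ℂ) :=
    { toFun := fun v => ![v ⬝ᵥ w', v i₀, v ⬝ᵥ w]
      map_add' := fun v v' => by simp [add_dotProduct]
      map_smul' := fun r v => by simp [smul_dotProduct] }
  have hf : Function.Injective f := by
    rw [injective_iff_map_eq_zero]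
    intro v hfv
    have e1 : v ⬝ᵥ w' = 0 := congrFun hfv 0
    have e2 : v i₀ = 0 := congrFun hfv 1
    have e3 : v ⬝ᵥ w = 0 := congrFun hfv 2
    by_contra hv
    have hcv : c = Projectivization.mk ℂ v hv :=
      point_eq_of_mem (hℓ.ne (by decide : (0 : Fin 4) ≠ 1)) (hc 0)
        (by rw [hw0]; exact e3) (hc 1) (by rw [hw1]; exact e1)
    rw [huc, Projectivization.mk_eq_mk_iff'] at hcv
    obtain ⟨r, hr⟩ := hcv
    exact hi₀ (by rw [← hr, Pi.smul_apply, e2, smul_zero])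
  let g : (Fin 3 → ℂ) ≃ₗ[ℂ] (Fin 3 → ℂ) := LinearEquiv.ofInjectiveEndo f hf
  have hgc : automorphism g c = verticalPoint := by
    have hgu : g u = ![0, u i₀, 0] := by
      change ![u ⬝ᵥ w', u i₀, u ⬝ᵥ w] = _
      rw [huw, huw']
    rw [huc, automorphism, Projectivization.map_mk, verticalPoint,
      Projectivization.mk_eq_mk_iff_crossProduct_eq_zero]
    change g u ⨯₃ _ = 0
    rw [hgu, cross_apply]
    simp
  have h0 (p : Plane) : automorphism g p ∈ line (columnLines 0 0) ↔ p ∈ line (ℓ 0) := by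
    induction p using Projectivization.ind with | h v hv =>
    rw [hw0, mk_mem_line]
    change ![v ⬝ᵥ w', v i₀, v ⬝ᵥ w] ⬝ᵥ ![0, 0, 1] = 0 ↔ _
    simp
  have hj (j : Fin 3) : ∃ r : ℂ, ∀ p, automorphism g p ∈ line
      (Projectivization.mk ℂ ![1, 0, -r] (by simp)) ↔ p ∈ line (ℓ j.succ) := by
    obtain ⟨ℓ', hℓ'⟩ := exists_line_preimage g.symm (ℓ j.succ)
    have hp (p : Plane) : automorphism g p ∈ line ℓ' ↔ p ∈ line (ℓ j.succ) := by
      rw [← hℓ', automorphism_symm_apply]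
    have hv : verticalPoint ∈ line ℓ' := by rw [← hgc, hp]; exact hc _
    induction ℓ' using Projectivization.ind with | h x hx =>
    have hx1 : x 1 = 0 := by
      rw [verticalPoint, mk_mem_line, Matrix.vec3_dotProduct] at hv
      simpa using hv
    -- Otherwise `ℓ'` would be the line at infinity, the image of `ℓ 0`.
    have hx0 : x 0 ≠ 0 := by
      intro hx0
      have hx' : Projectivization.mk ℂ x hx = columnLines 0 0 := by
        change _ = Projectivization.mk ℂ ![0, 0, 1] _
        rw [Projectivization.mk_eq_mk_iff_crossProduct_eq_zero, cross_apply]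
        simp [hx0, hx1]
      refine (Fin.succ_ne_zero j) (hℓ (line_injective ?_))
      ext p
      rw [← hp, ← h0, hx']
    refine ⟨-(x 2 / x 0), fun p => ?_⟩
    rw [← hp]
    have : (Projectivization.mk ℂ x hx : Plane) =
        Projectivization.mk ℂ ![1, 0, - -(x 2 / x 0)] (by simp) := by
      rw [Projectivization.mk_eq_mk_iff_crossProduct_eq_zero, cross_apply]
      ext i; fin_cases i <;> simp [hx1]
      field_simp; simp
    rw [this]
  choose a ha using hj
  have hall (i : Fin 4) (p : Plane) :
      automorphism g p ∈ line (columnLines a i) ↔ p ∈ line (ℓ i) := by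
    refine Fin.cases ?_ (fun j => ?_) i
    · exact h0 p
    · exact ha j p
  refine ⟨g, a, fun j k hjk => ?_, hgc, hall⟩
  refine Fin.succ_injective _ (hℓ (line_injective ?_))
  ext p
  rw [← hall, ← hall]
  simp [columnLines, hjk]

section Columns

variable {S : Set Plane} {a : Fin 3 → ℂ}

theorem eq_of_subset_columnLines (hsub : S ⊆ ⋃ i, line (columnLines a i)) {p : Plane}
    (hp : p ∈ S) : p = verticalPoint ∨ (∃ s, p = slopePoint s) ∨
      ∃ j y, p = affinePoint (a j) y := by
  obtain ⟨i, hi⟩ := Set.mem_iUnion.1 (hsub hp)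
  revert hi
  refine Fin.cases (fun hi => ?_) (fun j hi => ?_) i
  · exact (eq_of_mem_columnLines_zero hi).imp_right Or.inl
  · exact (eq_of_mem_columnLines_succ hi).imp_right fun ⟨y, hy⟩ => Or.inr ⟨j, y, hy⟩

/-- The line of slope `s` through a point of one column meets `S` in another column. -/
theorem IsSylvesterGallai.exists_column_of_slope (hS : IsSylvesterGallai S)
    (hsub : S ⊆ ⋃ i, line (columnLines a i)) {s y : ℂ} {j : Fin 3} (hs : slopePoint s ∈ S)
    (hy : affinePoint (a j) y ∈ S) :
    ∃ k, k ≠ j ∧ affinePoint (a k) (y + s * (a k - a j)) ∈ S := by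
  obtain ⟨r, hr, hrs, hry, hrl⟩ := hS.exists_third hs hy (slopePoint_ne_affinePoint _ _ _)
  rcases eq_of_subset_columnLines hsub hr with rfl | ⟨s', rfl⟩ | ⟨k, y', rfl⟩
  · rw [slopePoint, affinePoint, verticalPoint,
      mk_mem_line_cross _ _ _ (slopePoint_ne_affinePoint s (a j) y), cross_apply] at hrl
    simp at hrl
  · rw [slopePoint, affinePoint, slopePoint,
      mk_mem_line_cross _ _ _ (slopePoint_ne_affinePoint s (a j) y), cross_apply] at hrl
    simp at hrl
    exact absurd (by rw [show s' = s by linear_combination -hrl]) hrs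
  · rw [slopePoint, affinePoint, affinePoint,
      mk_mem_line_cross _ _ _ (slopePoint_ne_affinePoint s (a j) y), cross_apply] at hrl
    simp at hrl
    have e : y' = y + s * (a k - a j) := by linear_combination -hrl
    refine ⟨k, ?_, e ▸ hr⟩
    rintro rfl
    exact hry (by rw [e, sub_self, mul_zero, add_zero])

/-- The line through points of two columns has its slope in `S` or meets `S` in the third
column. -/
theorem IsSylvesterGallai.exists_third_column (hS : IsSylvesterGallai S)
    (hsub : S ⊆ ⋃ i, line (columnLines a i)) (ha : Function.Injective a) {y y' : ℂ}
    {j k l : Fin 3} (hjk : j ≠ k) (hkl : k ≠ l) (hjl : j ≠ l) (hy : affinePoint (a j) y ∈ S)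
    (hy' : affinePoint (a k) y' ∈ S) :
    slopePoint ((y' - y) / (a k - a j)) ∈ S ∨
      affinePoint (a l) (y + (y' - y) / (a k - a j) * (a l - a j)) ∈ S := by
  have hd : a k - a j ≠ 0 := sub_ne_zero.2 (ha.ne hjk.symm)
  have hne : affinePoint (a j) y ≠ affinePoint (a k) y' :=
    fun h => hjk (ha (affinePoint_inj.1 h).1)
  obtain ⟨r, hr, hry, hry', hrl⟩ := hS.exists_third hy hy' hne
  rcases eq_of_subset_columnLines hsub hr with rfl | ⟨s, rfl⟩ | ⟨i, z, rfl⟩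
  · rw [affinePoint, affinePoint, verticalPoint, mk_mem_line_cross _ _ _ hne, cross_apply] at hrl
    simp at hrl
    exact absurd (by linear_combination hrl) hd
  · rw [affinePoint, affinePoint, slopePoint, mk_mem_line_cross _ _ _ hne, cross_apply] at hrl
    simp at hrl
    left
    convert hr using 2
    field_simp
    linear_combination -hrl
  · rw [affinePoint, affinePoint, affinePoint, mk_mem_line_cross _ _ _ hne, cross_apply] at hrl
    simp at hrl
    have hz : z = y + (y' - y) / (a k - a j) * (a i - a j) := by
      field_simp
      linear_combination hrl
    have hij : i ≠ j := by
      rintro rfl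
      exact hry (by rw [hz, sub_self, mul_zero, add_zero])
    have hik : i ≠ k := by
      rintro rfl
      exact hry' (by rw [hz, div_mul_cancel₀ _ hd, add_sub_cancel])
    have : i = l := by omega
    subst this
    exact Or.inr (hz ▸ hr)

/-- The heights of the points of `S` in column `j`. -/
def column (S : Set Plane) (a : Fin 3 → ℂ) (j : Fin 3) : Set ℂ := {y | affinePoint (a j) y ∈ S}

theorem finite_column (hS : S.Finite) (j : Fin 3) : (column S a j).Finite :=
  hS.preimage fun _ _ _ _ h => (affinePoint_inj.1 h).2

theorem IsSylvesterGallai.column_nonempty (hS : IsSylvesterGallai S)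
    (hsub : S ⊆ ⋃ i, line (columnLines a i)) (ha : Function.Injective a) {s s' : ℂ}
    (hss : s ≠ s') (hs : slopePoint s ∈ S) (hs' : slopePoint s' ∈ S) (j : Fin 3) :
    (column S a j).Nonempty := by
  refine nonempty_of_two_slopes ha hss (finite_column hS.finite) ?_
    (fun j y hy => hS.exists_column_of_slope hsub hs hy)
    (fun j y hy => hS.exists_column_of_slope hsub hs' hy) j
  obtain ⟨p, hp, hpl⟩ := hS.exists_not_mem_line (columnLines a 0)
  rcases eq_of_subset_columnLines hsub hp with rfl | ⟨s, rfl⟩ | ⟨k, y, rfl⟩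
  · exact absurd (by change ![0, 1, 0] ⬝ᵥ ![0, 0, 1] = 0; simp) hpl
  · exact absurd (slopePoint_mem_columnLines a s) hpl
  · exact ⟨k, y, hp⟩

theorem IsSylvesterGallai.not_three_slopePoints (hS : IsSylvesterGallai S)
    (hsub : S ⊆ ⋃ i, line (columnLines a i)) (ha : Function.Injective a) {s : Fin 3 → ℂ}
    (hinj : Function.Injective s) (hs : ∀ i, slopePoint (s i) ∈ S) : False :=
  not_three_slopes ha hinj (finite_column hS.finite)
    (hS.column_nonempty hsub ha (hinj.ne (by decide : (0 : Fin 3) ≠ 1)) (hs 0) (hs 1))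
    fun i _ _ hy => hS.exists_column_of_slope hsub (hs i) hy

end Columns

section Pencil

/-- The points of `S` on the line `ℓ` other than `c`. -/
def pencilPart (S : Set Plane) (c ℓ : Plane) : Set Plane := (S ∩ line ℓ) \ {c}

variable {S : Set Plane} {c : Plane} {ℓ : Fin 4 → Plane}

theorem finite_pencilPart (hS : S.Finite) (c ℓ : Plane) : (pencilPart S c ℓ).Finite :=
  (hS.inter_of_left _).sdiff

theorem image_subset_columnLines {g : (Fin 3 → ℂ) ≃ₗ[ℂ] (Fin 3 → ℂ)} {a : Fin 3 → ℂ}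
    (hg : ∀ i p, automorphism g p ∈ line (columnLines a i) ↔ p ∈ line (ℓ i))
    (hsub : S ⊆ ⋃ i, line (ℓ i)) :
    automorphism g '' S ⊆ ⋃ i, line (columnLines a i) := by
  rintro _ ⟨p, hp, rfl⟩
  obtain ⟨i, hi⟩ := Set.mem_iUnion.1 (hsub hp)
  exact Set.mem_iUnion.2 ⟨i, (hg i p).2 hi⟩

theorem exists_slopePoint_of_mem_pencilPart {g : (Fin 3 → ℂ) ≃ₗ[ℂ] (Fin 3 → ℂ)}
    {a : Fin 3 → ℂ} (hgc : automorphism g c = verticalPoint)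
    (hg : ∀ i p, automorphism g p ∈ line (columnLines a i) ↔ p ∈ line (ℓ i)) {p : Plane}
    (hp : p ∈ pencilPart S c (ℓ 0)) : ∃ s, automorphism g p = slopePoint s :=
  (eq_of_mem_columnLines_zero ((hg 0 p).2 hp.1.2)).resolve_left fun h =>
    hp.2 (automorphism_injective g (h.trans hgc.symm))

theorem exists_affinePoint_of_mem_pencilPart {g : (Fin 3 → ℂ) ≃ₗ[ℂ] (Fin 3 → ℂ)}
    {a : Fin 3 → ℂ} (hgc : automorphism g c = verticalPoint)
    (hg : ∀ i p, automorphism g p ∈ line (columnLines a i) ↔ p ∈ line (ℓ i)) {p : Plane}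
    {j : Fin 3} (hp : p ∈ pencilPart S c (ℓ j.succ)) :
    ∃ y, automorphism g p = affinePoint (a j) y :=
  (eq_of_mem_columnLines_succ ((hg _ p).2 hp.1.2)).resolve_left fun h =>
    hp.2 (automorphism_injective g (h.trans hgc.symm))

theorem IsSylvesterGallai.ncard_pencilPart_le (hS : IsSylvesterGallai S)
    (hℓ : Function.Injective ℓ) (hc : ∀ i, c ∈ line (ℓ i)) (hsub : S ⊆ ⋃ i, line (ℓ i))
    (i : Fin 4) : (pencilPart S c (ℓ i)).ncard ≤ 2 := by
  wlog hi : i = 0 generalizing i ℓ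
  · have := this (ℓ := ℓ ∘ Equiv.swap 0 i) (hℓ.comp (Equiv.injective _)) (fun j => hc _)
      (hsub.trans_eq (Equiv.iSup_comp (g := fun j => line (ℓ j)) (Equiv.swap 0 i)).symm) 0 rfl
    simpa using this
  subst hi
  by_contra! hlt
  obtain ⟨g, a, ha, hgc, hg⟩ := exists_automorphism_columnLines hℓ hc
  obtain ⟨p, q, r, hp, hq, hr, hpq, hpr, hqr⟩ :=
    (Set.two_lt_ncard_iff (finite_pencilPart hS.finite _ _)).1 hlt
  obtain ⟨s, hs⟩ := exists_slopePoint_of_mem_pencilPart hgc hg hp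
  obtain ⟨t, ht⟩ := exists_slopePoint_of_mem_pencilPart hgc hg hq
  obtain ⟨u, hu⟩ := exists_slopePoint_of_mem_pencilPart hgc hg hr
  have hst : s ≠ t := fun h => hpq (automorphism_injective g (by rw [hs, ht, h]))
  have hsu : s ≠ u := fun h => hpr (automorphism_injective g (by rw [hs, hu, h]))
  have htu : t ≠ u := fun h => hqr (automorphism_injective g (by rw [ht, hu, h]))
  refine (isSylvesterGallai_image hS g).not_three_slopePoints (image_subset_columnLines hg hsub)
    ha (s := ![s, t, u]) ?_ fun i => ?_
  · intro i j hij
    fin_cases i <;> fin_cases j <;>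
      simp [hst, hsu, htu, hst.symm, hsu.symm, htu.symm] at hij ⊢
  · fin_cases i
    exacts [hs ▸ ⟨p, hp.1.1, rfl⟩, ht ▸ ⟨q, hq.1.1, rfl⟩, hu ▸ ⟨r, hr.1.1, rfl⟩]

theorem IsSylvesterGallai.pencilPart_nonempty (hS : IsSylvesterGallai S)
    (hℓ : Function.Injective ℓ) (hc : ∀ i, c ∈ line (ℓ i)) (hsub : S ⊆ ⋃ i, line (ℓ i))
    {i : Fin 4} (hi : (pencilPart S c (ℓ i)).ncard = 2) (j : Fin 4) :
    (pencilPart S c (ℓ j)).Nonempty := by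
  wlog hi0 : i = 0 generalizing i j ℓ
  · have := this (ℓ := ℓ ∘ Equiv.swap 0 i) (hℓ.comp (Equiv.injective _)) (fun j => hc _)
      (hsub.trans_eq (Equiv.iSup_comp (g := fun j => line (ℓ j)) (Equiv.swap 0 i)).symm)
      (i := 0) (by simpa using hi) (Equiv.swap 0 i j) rfl
    simpa using this
  subst hi0
  obtain ⟨g, a, ha, hgc, hg⟩ := exists_automorphism_columnLines hℓ hc
  obtain ⟨p, q, hpq, he⟩ := Set.ncard_eq_two.1 hi
  have hp : p ∈ pencilPart S c (ℓ 0) := he ▸ by simp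
  have hq : q ∈ pencilPart S c (ℓ 0) := he ▸ by simp
  induction j using Fin.cases with
  | zero => exact ⟨p, hp⟩
  | succ j =>
    obtain ⟨s, hs⟩ := exists_slopePoint_of_mem_pencilPart hgc hg hp
    obtain ⟨t, ht⟩ := exists_slopePoint_of_mem_pencilPart hgc hg hq
    have hst : s ≠ t := fun h => hpq (automorphism_injective g (by rw [hs, ht, h]))
    obtain ⟨y, z, hz, hzy⟩ := (isSylvesterGallai_image hS g).column_nonempty
      (image_subset_columnLines hg hsub) ha hst (hs ▸ ⟨p, hp.1.1, rfl⟩) (ht ▸ ⟨q, hq.1.1, rfl⟩) j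
    refine ⟨z, ⟨hz, (hg _ z).1 (hzy ▸ affinePoint_mem_columnLines a j y)⟩, ?_⟩
    rintro rfl
    exact affinePoint_ne_verticalPoint _ _ (hzy.symm.trans hgc)

/-- The line `ℓ i` of the pencil is not ordinary. -/
theorem IsSylvesterGallai.ncard_pencilPart_ne (hS : IsSylvesterGallai S)
    (hc : ∀ i, c ∈ line (ℓ i)) (i : Fin 4) :
    (c ∈ S → (pencilPart S c (ℓ i)).ncard ≠ 1) ∧ (c ∉ S → (pencilPart S c (ℓ i)).ncard ≠ 2) := by
  constructor
  · intro h h1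
    have := hS.no_ordinary (ℓ i)
    rw [IsOrdinaryLine, ← Set.ncard_sdiff_singleton_add_one (show c ∈ S ∩ line (ℓ i) from ⟨h, hc i⟩)
      (hS.finite.inter_of_left _)] at this
    exact this (congrArg (· + 1) h1)
  · intro h h2
    refine hS.no_ordinary (ℓ i) ?_
    rw [IsOrdinaryLine, ← h2, pencilPart, Set.sdiff_singleton_eq_self fun h' => h h'.1]

theorem diff_singleton_eq_iUnion_pencilPart (hsub : S ⊆ ⋃ i, line (ℓ i)) :
    S \ {c} = ⋃ i, pencilPart S c (ℓ i) := by
  ext p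
  simp only [pencilPart, Set.mem_sdiff, Set.mem_iUnion, Set.mem_inter_iff]
  constructor
  · rintro ⟨hp, hpc⟩
    obtain ⟨i, hi⟩ := Set.mem_iUnion.1 (hsub hp)
    exact ⟨i, ⟨hp, hi⟩, hpc⟩
  · rintro ⟨i, ⟨hp, -⟩, hpc⟩
    exact ⟨hp, hpc⟩

theorem ncard_diff_singleton_eq_sum (hS : S.Finite) (hℓ : Function.Injective ℓ)
    (hc : ∀ i, c ∈ line (ℓ i)) (hsub : S ⊆ ⋃ i, line (ℓ i)) :
    (S \ {c}).ncard = ∑ i, (pencilPart S c (ℓ i)).ncard := by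
  rw [diff_singleton_eq_iUnion_pencilPart hsub,
    Set.ncard_iUnion_of_finite (fun i => finite_pencilPart hS _ _), finsum_eq_sum_of_fintype]
  intro i j hij
  rw [Function.onFun, Set.disjoint_left]
  intro p hp hp'
  exact hp.2 (point_eq_of_mem (hℓ.ne hij) hp.1.2 (hc i) hp'.1.2 (hc j))

/-- Every line of the pencil carries `c` and exactly two further points of `S`. -/
theorem IsSylvesterGallai.pencil_structure (hS : IsSylvesterGallai S)
    (hℓ : Function.Injective ℓ) (hc : ∀ i, c ∈ line (ℓ i)) (hsub : S ⊆ ⋃ i, line (ℓ i)) :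
    c ∈ S ∧ ∀ i, (pencilPart S c (ℓ i)).ncard = 2 := by
  have hle := hS.ncard_pencilPart_le hℓ hc hsub
  have hne := hS.ncard_pencilPart_ne hc
  have hsum := ncard_diff_singleton_eq_sum hS.finite hℓ hc hsub
  have hcard := hS.four_lt_ncard
  -- Otherwise each line of the pencil has at most one point of `S`, four in total.
  have hcS : c ∈ S := by
    by_contra hcS
    rw [Set.sdiff_singleton_eq_self hcS] at hsum
    have : ∑ i, (pencilPart S c (ℓ i)).ncard ≤ ∑ _i : Fin 4, 1 :=
      Finset.sum_le_sum fun i _ => by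
        have h1 := hle i
        have h2 := (hne i).2 hcS
        omega
    simp at this
    omega
  refine ⟨hcS, ?_⟩
  obtain ⟨i₀, hi₀⟩ : ∃ i, (pencilPart S c (ℓ i)).ncard = 2 := by
    by_contra! h
    have : ∑ i, (pencilPart S c (ℓ i)).ncard = 0 := Finset.sum_eq_zero fun i _ => by
      have h1 := hle i
      have h2 := (hne i).1 hcS
      have h3 := h i
      omega
    have := Set.ncard_sdiff_singleton_add_one hcS hS.finite
    omega
  intro i
  have h1 := hle i
  have h2 := (hne i).1 hcS
  have h3 := (Set.ncard_pos (finite_pencilPart hS.finite _ _)).2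
    (hS.pencilPart_nonempty hℓ hc hsub hi₀ i)
  omega

theorem IsSylvesterGallai.ncard_eq_nine (hS : IsSylvesterGallai S)
    (hℓ : Function.Injective ℓ) (hc : ∀ i, c ∈ line (ℓ i)) (hsub : S ⊆ ⋃ i, line (ℓ i)) :
    S.ncard = 9 := by
  obtain ⟨hcS, h2⟩ := hS.pencil_structure hℓ hc hsub
  rw [← Set.ncard_sdiff_singleton_add_one hcS hS.finite,
    ncard_diff_singleton_eq_sum hS.finite hℓ hc hsub]
  simp [h2]

end Pencil

/-! ### The configuration of nine points -/

theorem eq_pair_of_ncard_eq_two {α : Type*} {X : Set α} (hX : X.ncard = 2) {u v : α}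
    (hu : u ∈ X) (hv : v ∈ X) (huv : u ≠ v) : X = {u, v} := by
  refine (Set.eq_of_subset_of_ncard_le (Set.pair_subset hu hv) ?_
    (Set.finite_of_ncard_ne_zero (by omega))).symm
  rw [hX, Set.ncard_pair huv]

theorem eq_of_subset_of_forall_mem {α : Type*} {X Y Z : Set α} (hX : X.ncard = 2)
    (hY : Y.ncard = 2) (hZ : Z.ncard = 2) (h : ∀ z ∈ Z, z ∈ X ∨ z ∈ Y) (hXY : X ⊆ Y) :
    X = Y ∧ Y = Z := by
  have e : X = Y := Set.eq_of_subset_of_ncard_le hXY (by omega)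
    (Set.finite_of_ncard_ne_zero (by omega))
  subst e
  refine ⟨rfl, (Set.eq_of_subset_of_ncard_le (fun z hz => (h z hz).elim id id) (by omega)
    (Set.finite_of_ncard_ne_zero (by omega))).symm⟩

/-- Three pairs whose union covers each of its points at least twice either coincide or are the
three sides of a triangle. -/
theorem eq_or_triangle {α : Type*} {X Y Z : Set α} (hX : X.ncard = 2) (hY : Y.ncard = 2)
    (hZ : Z.ncard = 2) (h1 : ∀ x ∈ X, x ∈ Y ∨ x ∈ Z) (h2 : ∀ y ∈ Y, y ∈ Z ∨ y ∈ X)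
    (h3 : ∀ z ∈ Z, z ∈ X ∨ z ∈ Y) :
    (X = Y ∧ Y = Z) ∨ ∃ u v w, u ≠ v ∧ v ≠ w ∧ w ≠ u ∧ X = {u, v} ∧ Y = {v, w} ∧ Z = {w, u} := by
  by_cases hXY : X ⊆ Y
  · exact Or.inl (eq_of_subset_of_forall_mem hX hY hZ h3 hXY)
  by_cases hYZ : Y ⊆ Z
  · obtain ⟨rfl, rfl⟩ := eq_of_subset_of_forall_mem hY hZ hX h1 hYZ
    exact Or.inl ⟨rfl, rfl⟩
  by_cases hZX : Z ⊆ X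
  · obtain ⟨rfl, rfl⟩ := eq_of_subset_of_forall_mem hZ hX hY h2 hZX
    exact Or.inl ⟨rfl, rfl⟩
  obtain ⟨u, huX, huY⟩ := Set.not_subset.1 hXY
  obtain ⟨v, hvY, hvZ⟩ := Set.not_subset.1 hYZ
  obtain ⟨w, hwZ, hwX⟩ := Set.not_subset.1 hZX
  have huZ := (h1 u huX).resolve_left huY
  have hvX := (h2 v hvY).resolve_left hvZ
  have hwY := (h3 w hwZ).resolve_left hwX
  have huv : u ≠ v := fun h => huY (h ▸ hvY)
  have hvw : v ≠ w := fun h => hvZ (h ▸ hwZ)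
  have hwu : w ≠ u := fun h => hwX (h ▸ huX)
  exact Or.inr ⟨u, v, w, huv, hvw, hwu, eq_pair_of_ncard_eq_two hX huX hvX huv,
    eq_pair_of_ncard_eq_two hY hvY hwY hvw, eq_pair_of_ncard_eq_two hZ hwZ huZ hwu⟩

/-- The heights of the column `A` over `x = r`, measured along the lines of slope `s`: the
intercepts with `x = 0` of the lines of slope `s` through the points of the column. -/
def intercepts (A : Set ℂ) (s r : ℂ) : Set ℂ := {b | b + s * r ∈ A}

theorem ncard_intercepts (A : Set ℂ) (s r : ℂ) : (intercepts A s r).ncard = A.ncard := by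
  have : intercepts A s r = (fun y => y - s * r) '' A := by
    ext b
    constructor
    · intro hb
      exact ⟨_, hb, by ring⟩
    · rintro ⟨y, hy, rfl⟩
      simpa [intercepts] using hy
  rw [this, Set.ncard_image_of_injective _ (sub_left_injective)]

/-- If every point has a partner along the two slopes `s` and `t`, then the lines of slope `s`
pair the columns along a triangle. They cannot all meet three columns: the lines of slope `t`
would then make each `a j` the midpoint of the other two. -/
theorem exists_triangle {A : Fin 3 → Set ℂ} {a : Fin 3 → ℂ} {s t : ℂ}
    (ha : Function.Injective a) (hst : s ≠ t) (hA : ∀ j, (A j).ncard = 2)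
    (hs : ∀ j, ∀ y ∈ A j, ∃ k, k ≠ j ∧ y + s * (a k - a j) ∈ A k)
    (ht : ∀ j, ∀ y ∈ A j, ∃ k, k ≠ j ∧ y + t * (a k - a j) ∈ A k) :
    ∃ u v w, u ≠ v ∧ v ≠ w ∧ w ≠ u ∧ intercepts (A 0) s (a 0) = {u, v} ∧
      intercepts (A 1) s (a 1) = {v, w} ∧ intercepts (A 2) s (a 2) = {w, u} := by
  have hs' {j : Fin 3} {b : ℂ} (hb : b ∈ intercepts (A j) s (a j)) :
      ∃ k, k ≠ j ∧ b ∈ intercepts (A k) s (a k) := by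
    obtain ⟨k, hk, h⟩ := hs j _ hb
    refine ⟨k, hk, ?_⟩
    change b + s * a k ∈ A k
    convert h using 1
    ring
  have two {j k l : Fin 3} (hjkl : ∀ i, i ≠ j → i = k ∨ i = l) {b : ℂ}
      (hb : b ∈ intercepts (A j) s (a j)) :
      b ∈ intercepts (A k) s (a k) ∨ b ∈ intercepts (A l) s (a l) := by
    obtain ⟨i, hi, h⟩ := hs' hb
    rcases hjkl i hi with rfl | rfl
    exacts [Or.inl h, Or.inr h]
  refine (eq_or_triangle ((ncard_intercepts _ _ _).trans (hA 0))
    ((ncard_intercepts _ _ _).trans (hA 1)) ((ncard_intercepts _ _ _).trans (hA 2))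
    (fun _ h => two (by decide) h) (fun _ h => two (by decide) h)
    (fun _ h => two (by decide) h)).resolve_left ?_
  rintro ⟨h01, h12⟩
  obtain ⟨p, q, hpq, h0⟩ := Set.ncard_eq_two.1 ((ncard_intercepts _ s (a 0)).trans (hA 0))
  have hall (j : Fin 3) : intercepts (A j) s (a j) = {p, q} := by
    fin_cases j
    exacts [h0, h01 ▸ h0, h12 ▸ h01 ▸ h0]
  have step {b b' : ℂ} (hbb : ({p, q} : Set ℂ) = {b, b'}) (j : Fin 3) :
      ∃ k, k ≠ j ∧ (t - s) * (a k - a j) = b' - b := by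
    have hb : b ∈ intercepts (A j) s (a j) := by rw [hall, hbb]; simp
    obtain ⟨k, hk, h⟩ := ht j _ hb
    have : b + (t - s) * (a k - a j) ∈ intercepts (A k) s (a k) := by
      change _ ∈ A k
      convert h using 1
      ring
    rw [hall, hbb] at this
    refine ⟨k, hk, ?_⟩
    rcases this with h | h
    · have h0 : (t - s) * (a k - a j) = 0 := by linear_combination h
      exact absurd h0 (mul_ne_zero (sub_ne_zero.2 hst.symm) (sub_ne_zero.2 (ha.ne hk)))
    · rw [Set.mem_singleton_iff] at h
      linear_combination h
  have mid {j k l : Fin 3} (hjkl : ∀ i, i ≠ j → i = k ∨ i = l) : a k + a l = 2 * a j := by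
    obtain ⟨i, hi, h⟩ := step rfl j
    obtain ⟨i', hi', h'⟩ := step (Set.pair_comm p q) j
    have hne : i ≠ i' := by
      rintro rfl
      exact hpq (by linear_combination (h - h') / 2)
    have e : a i + a i' = 2 * a j := by
      have : (t - s) * (a i + a i' - 2 * a j) = 0 := by linear_combination h + h'
      exact sub_eq_zero.1 ((mul_eq_zero.1 this).resolve_left (sub_ne_zero.2 hst.symm))
    rcases hjkl i hi with rfl | rfl <;> rcases hjkl i' hi' with rfl | rfl
    · exact absurd rfl hne
    · exact e
    · rw [add_comm]; exact e
    · exact absurd rfl hne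
  have e0 := mid (j := 0) (k := 1) (l := 2) (by decide)
  have e1 := mid (j := 1) (k := 0) (l := 2) (by decide)
  exact ha.ne (by decide : (0 : Fin 3) ≠ 1) (by linear_combination (e1 - e0) / 3)

/-- If the sides of the triangle `u v w` are translates by the different numbers `x`, `y`, `z` of
those of `U V W`, then the translations exchange the ends of the sides. A side whose ends are kept
makes two of the translations agree unless both other sides are exchanged, and adding up the three
sides as vectors excludes that. -/
theorem eq_of_side_translates {u v w U V W x y z : ℂ} (hUV : U ≠ V) (hVW : V ≠ W) (hWU : W ≠ U)
    (hxy : x ≠ y) (hxz : x ≠ z) (hyz : y ≠ z)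
    (h0 : (u = U + x ∧ v = V + x) ∨ (u = V + x ∧ v = U + x))
    (h1 : (v = V + y ∧ w = W + y) ∨ (v = W + y ∧ w = V + y))
    (h2 : (w = W + z ∧ u = U + z) ∨ (w = U + z ∧ u = W + z)) :
    x = u + v - (u + U) ∧ y = v + w - (u + U) ∧ z = w + u - (u + U) := by
  rcases h0 with ⟨a, b⟩ | ⟨a, b⟩ <;> rcases h1 with ⟨c, d⟩ | ⟨c, d⟩ <;>
    rcases h2 with ⟨e, f⟩ | ⟨e, f⟩
  · exact absurd (by linear_combination c - b) hxy
  · exact absurd (by linear_combination c - b) hxy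
  · exact absurd (by linear_combination f - a) hxz
  · exact absurd (by linear_combination (b - a + d - c + f - e) / 2) hUV
  · exact absurd (by linear_combination e - d) hyz
  · exact absurd (by linear_combination (b - a + d - c + f - e) / 2) hVW
  · exact absurd (by linear_combination (b - a + d - c + f - e) / 2) hWU
  · exact ⟨by linear_combination -b, by linear_combination a - b - d,
      by linear_combination -e⟩

/-- The triangles of the slopes `s` and `t` determine the position of the columns. -/
theorem exists_column_positions {A : Fin 3 → Set ℂ} {a : Fin 3 → ℂ} {s t : ℂ}
    (ha : Function.Injective a) (hst : s ≠ t) (hA : ∀ j, (A j).ncard = 2)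
    (hs : ∀ j, ∀ y ∈ A j, ∃ k, k ≠ j ∧ y + s * (a k - a j) ∈ A k)
    (ht : ∀ j, ∀ y ∈ A j, ∃ k, k ≠ j ∧ y + t * (a k - a j) ∈ A k) :
    ∃ u v w κ, u ≠ v ∧ v ≠ w ∧ w ≠ u ∧ intercepts (A 0) s (a 0) = {u, v} ∧
      intercepts (A 1) s (a 1) = {v, w} ∧ intercepts (A 2) s (a 2) = {w, u} ∧
      (t - s) * a 0 = u + v - κ ∧ (t - s) * a 1 = v + w - κ ∧ (t - s) * a 2 = w + u - κ := by
  obtain ⟨u, v, w, huv, hvw, hwu, h0, h1, h2⟩ := exists_triangle ha hst hA hs ht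
  obtain ⟨U, V, W, hUV, hVW, hWU, H0, H1, H2⟩ := exists_triangle ha hst.symm hA ht hs
  have key {j : Fin 3} {x y X Y : ℂ} (h : intercepts (A j) s (a j) = {x, y})
      (H : intercepts (A j) t (a j) = {X, Y}) (hxy : x ≠ y) :
      (x = X + (t - s) * a j ∧ y = Y + (t - s) * a j) ∨
      (x = Y + (t - s) * a j ∧ y = X + (t - s) * a j) := by
    have mem {b : ℂ} (hb : b ∈ intercepts (A j) s (a j)) :
        b = X + (t - s) * a j ∨ b = Y + (t - s) * a j := by
      have : b - (t - s) * a j ∈ intercepts (A j) t (a j) := by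
        change _ ∈ A j
        convert (show b + s * a j ∈ A j from hb) using 1
        ring
      rw [H] at this
      rcases this with e | e
      · exact Or.inl (by linear_combination e)
      · rw [Set.mem_singleton_iff] at e
        exact Or.inr (by linear_combination e)
    rcases mem (b := x) (by rw [h]; simp) with e | e <;>
    rcases mem (b := y) (by rw [h]; simp) with e' | e'
    · exact absurd (e.trans e'.symm) hxy
    · exact Or.inl ⟨e, e'⟩
    · exact Or.inr ⟨e, e'⟩
    · exact absurd (e.trans e'.symm) hxy
  have d {i j : Fin 3} (hij : i ≠ j) : (t - s) * a i ≠ (t - s) * a j := fun h =>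
    ha.ne hij (mul_left_cancel₀ (sub_ne_zero.2 hst.symm) h)
  have d01 := d (i := 0) (j := 1) (by decide)
  have d02 := d (i := 0) (j := 2) (by decide)
  have d12 := d (i := 1) (j := 2) (by decide)
  have k0 := key h0 H0 huv
  have k1 := key h1 H1 hvw
  have k2 := key h2 H2 hwu
  obtain ⟨r0, r1, r2⟩ := eq_of_side_translates hUV hVW hWU d01 d02 d12 k0 k1 k2
  exact ⟨u, v, w, u + U, huv, hvw, hwu, h0, h1, h2, r0, r1, r2⟩

/-- The slopes between the columns force the intercepts to form an equilateral triangle. -/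
theorem IsSylvesterGallai.exists_equilateral {S : Set Plane} {a : Fin 3 → ℂ}
    (hS : IsSylvesterGallai S) (hsub : S ⊆ ⋃ i, line (columnLines a i))
    (ha : Function.Injective a) {s t : ℂ} (hst : s ≠ t) (hs : slopePoint s ∈ S)
    (ht : slopePoint t ∈ S) (hE : ∀ r, slopePoint r ∈ S → r = s ∨ r = t)
    (hA : ∀ j, (column S a j).ncard = 2) :
    ∃ u v w κ, u ≠ v ∧ v ≠ w ∧ w ≠ u ∧ (v - u) * (w - v) = (w - u) ^ 2 ∧
      intercepts (column S a 0) s (a 0) = {u, v} ∧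
      intercepts (column S a 1) s (a 1) = {v, w} ∧
      intercepts (column S a 2) s (a 2) = {w, u} ∧
      (t - s) * a 0 = u + v - κ ∧ (t - s) * a 1 = v + w - κ ∧ (t - s) * a 2 = w + u - κ := by
  obtain ⟨u, v, w, κ, huv, hvw, hwu, h0, h1, h2, e0, e1, e2⟩ := exists_column_positions ha hst hA
    (fun j y hy => hS.exists_column_of_slope hsub hs hy)
    (fun j y hy => hS.exists_column_of_slope hsub ht hy)
  refine ⟨u, v, w, κ, huv, hvw, hwu, ?_, h0, h1, h2, e0, e1, e2⟩
  have hu : affinePoint (a 0) (u + s * a 0) ∈ S :=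
    (show u ∈ intercepts (column S a 0) s (a 0) by rw [h0]; simp)
  have hv : affinePoint (a 1) (v + s * a 1) ∈ S :=
    (show v ∈ intercepts (column S a 1) s (a 1) by rw [h1]; simp)
  -- The slope of the line through these two points is neither `s` nor `t`, which would give `u = v`
  -- or `v = w`; so its third point lies in column `2`.
  have hd : a 1 - a 0 ≠ 0 := sub_ne_zero.2 (ha.ne (by decide))
  have hδ : t - s ≠ 0 := sub_ne_zero.2 hst.symm
  rcases hS.exists_third_column hsub ha (j := 0) (k := 1) (l := 2) (by decide) (by decide)
    (by decide) hu hv with h | h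
  · exfalso
    rcases hE _ h with h | h
    · rw [div_eq_iff hd] at h
      exact huv (by linear_combination -h)
    · rw [div_eq_iff hd] at h
      exact hvw (by linear_combination h + e1 - e0)
  · have h' : u + (v - u) / (a 1 - a 0) * (a 2 - a 0) ∈ intercepts (column S a 2) s (a 2) := by
      change affinePoint (a 2) _ ∈ S
      convert h using 2
      field_simp
      ring
    rw [h2] at h'
    rcases h' with h' | h'
    · field_simp at h'
      linear_combination (t - s) * h' - (v - u) * (e2 - e0) + (w - u) * (e1 - e0)
    · exfalso
      rw [Set.mem_singleton_iff, add_eq_left] at h'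
      refine mul_ne_zero (div_ne_zero (sub_ne_zero.2 huv.symm) hd)
        (sub_ne_zero.2 (ha.ne (by decide))) h'

theorem exists_equilateral_coordinates {u v w : ℂ} (huv : u ≠ v)
    (h : (v - u) * (w - v) = (w - u) ^ 2) :
    ∃ m ρ ω : ℂ, ρ ≠ 0 ∧ ω ^ 2 + ω + 1 = 0 ∧ u = m + ρ ∧ v = m + ρ * ω ∧ w = m + ρ * ω ^ 2 := by
  have hd : v - u ≠ 0 := sub_ne_zero.2 huv.symm
  obtain ⟨ω, hω⟩ : ∃ ω, w - v = ω * (v - u) := ⟨(w - v) / (v - u), by field_simp⟩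
  have hq : ω ^ 2 + ω + 1 = 0 := by
    have : (v - u) ^ 2 * (ω ^ 2 + ω + 1) = 0 := by
      have : w - u = (1 + ω) * (v - u) := by linear_combination hω
      rw [this, hω] at h
      linear_combination -h
    exact (mul_eq_zero.1 this).resolve_left (pow_ne_zero 2 hd)
  have h1 : ω - 1 ≠ 0 := by
    intro h1
    rw [sub_eq_zero.1 h1] at hq
    norm_num at hq
  obtain ⟨ρ, hρ⟩ : ∃ ρ, v - u = ρ * (ω - 1) := ⟨(v - u) / (ω - 1), by field_simp⟩
  refine ⟨u - ρ, ρ, ω, ?_, hq, by ring, by linear_combination hρ, ?_⟩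
  · rintro rfl
    exact hd (by rw [hρ, zero_mul])
  · linear_combination hω + (1 + ω) * hρ

/-- Nine points in the position found by `IsSylvesterGallai.exists_equilateral` are Hesse points
in suitable coordinates: the triangle of the new coordinate axes has the line at infinity as one
of its sides. -/
theorem exists_automorphism_mem_hessePoints {S : Set Plane} {a : Fin 3 → ℂ}
    (hsub : S ⊆ ⋃ i, line (columnLines a i)) {s t u v w κ : ℂ} (hst : s ≠ t)
    (hE : ∀ r, slopePoint r ∈ S → r = s ∨ r = t) (huv : u ≠ v)
    (h : (v - u) * (w - v) = (w - u) ^ 2)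
    (h0 : intercepts (column S a 0) s (a 0) = {u, v})
    (h1 : intercepts (column S a 1) s (a 1) = {v, w})
    (h2 : intercepts (column S a 2) s (a 2) = {w, u})
    (e0 : (t - s) * a 0 = u + v - κ) (e1 : (t - s) * a 1 = v + w - κ)
    (e2 : (t - s) * a 2 = w + u - κ) :
    ∃ g : (Fin 3 → ℂ) ≃ₗ[ℂ] (Fin 3 → ℂ), ∀ p ∈ S, automorphism g p ∈ hessePoints := by
  obtain ⟨m, ρ, ω, hρ, hq, rfl, rfl, rfl⟩ := exists_equilateral_coordinates huv h
  have hω : ω ^ 3 = 1 := by linear_combination (ω - 1) * hq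
  have hne : ω - ω ^ 2 ≠ 0 := by
    intro h
    have h1 : ω = 1 := by linear_combination (1 + ω) * h + hω
    rw [h1] at hq
    norm_num at hq
  -- The new affine coordinates `X`, `Y` of the six affine points are pairs of different vertices
  -- of the triangle `ρ`, `ρ * ω`, `ρ * ω ^ 2`.
  let X (x : Fin 3 → ℂ) : ℂ := (2 * m - κ) * x 2 - (t - s) * x 0
  let Y (x : Fin 3 → ℂ) : ℂ := x 1 - s * x 0 - m * x 2
  let f : (Fin 3 → ℂ) →ₗ[ℂ] (Fin 3 → ℂ) :=
    { toFun := fun x => ![-(X x - ω * Y x), X x - ω ^ 2 * Y x, -((ω - ω ^ 2) * ρ * x 2)]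
      map_add' := fun x y => by
        ext i; fin_cases i <;> simp [X, Y] <;> ring
      map_smul' := fun r x => by
        ext i; fin_cases i <;> simp [X, Y] <;> ring }
  have hf : Function.Injective f := by
    rw [injective_iff_map_eq_zero]
    intro x hx
    have f0 : -(X x - ω * Y x) = 0 := congrFun hx 0
    have f1 : X x - ω ^ 2 * Y x = 0 := congrFun hx 1
    have f2 : -((ω - ω ^ 2) * ρ * x 2) = 0 := congrFun hx 2
    have x2 : x 2 = 0 := (mul_eq_zero.1 (neg_eq_zero.1 f2)).resolve_left (mul_ne_zero hne hρ)
    have hY : Y x = 0 := by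
      have : (ω - ω ^ 2) * Y x = 0 := by linear_combination f0 + f1
      exact (mul_eq_zero.1 this).resolve_left hne
    have hX : X x = 0 := by linear_combination f1 + ω ^ 2 * hY
    have x0 : x 0 = 0 := by
      have : (t - s) * x 0 = 0 := by
        simp only [X, x2] at hX
        linear_combination -hX
      exact (mul_eq_zero.1 this).resolve_left (sub_ne_zero.2 hst.symm)
    have x1 : x 1 = 0 := by
      simp only [Y, x2, x0] at hY
      linear_combination hY
    exact funext fun i => by fin_cases i <;> simp [x0, x1, x2]
  let g : (Fin 3 → ℂ) ≃ₗ[ℂ] (Fin 3 → ℂ) := LinearEquiv.ofInjectiveEndo f hf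
  have mem {x : Fin 3 → ℂ} (hx : x ≠ 0) (hc : (-(X x - ω * Y x)) ^ 3 + (X x - ω ^ 2 * Y x) ^ 3 +
        (-((ω - ω ^ 2) * ρ * x 2)) ^ 3 = 0)
      (hp : -(X x - ω * Y x) * (X x - ω ^ 2 * Y x) * (-((ω - ω ^ 2) * ρ * x 2)) = 0) :
      automorphism g (Projectivization.mk ℂ x hx) ∈ hessePoints := by
    rw [automorphism, Projectivization.map_mk, mk_mem_hessePoints]
    exact ⟨hc, hp⟩
  have memA {x y : ℂ} (hy : (Y ![x, y, 1]) ^ 3 = ρ ^ 3)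
      (hxy : X ![x, y, 1] = ω * Y ![x, y, 1] ∨ X ![x, y, 1] = ω ^ 2 * Y ![x, y, 1]) :
      automorphism g (affinePoint x y) ∈ hessePoints := by
    have e : (![x, y, 1] : Fin 3 → ℂ) 2 = 1 := rfl
    rcases hxy with hxy | hxy
    · refine mem _ ?_ ?_ <;> rw [hxy, e]
      · linear_combination (ω - ω ^ 2) ^ 3 * hy
      · ring
    · refine mem _ ?_ ?_ <;> rw [hxy, e]
      · linear_combination (ω - ω ^ 2) ^ 3 * hy
      · ring
  have hXaff (x y : ℂ) : X ![x, y, 1] = 2 * m - κ - (t - s) * x := by simp [X]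
  have hYaff (x b : ℂ) : Y ![x, b + s * x, 1] = b - m := by simp [Y]
  refine ⟨g, fun p hp => ?_⟩
  rcases eq_of_subset_columnLines hsub hp with rfl | ⟨r, rfl⟩ | ⟨j, y, rfl⟩
  · refine mem _ ?_ ?_ <;> simp [X, Y]
    linear_combination -ω ^ 3 * hω
  · have hr : r = s ∨ r = t := hE r hp
    rcases hr with rfl | rfl
    · refine mem _ ?_ ?_ <;> simp [X, Y]
      ring
    · refine mem _ ?_ ?_ <;> simp [X, Y]
      linear_combination (r - s) ^ 3 * (ω - ω ^ 2) * (ω ^ 2 + 3) * hq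
  · obtain ⟨b, rfl⟩ : ∃ b, y = b + s * a j := ⟨y - s * a j, by ring⟩
    have hb : b ∈ intercepts (column S a j) s (a j) := hp
    fin_cases j
    · change b ∈ intercepts (column S a 0) s (a 0) at hb
      change automorphism g (affinePoint (a 0) (b + s * a 0)) ∈ hessePoints
      rw [h0] at hb
      rcases hb with rfl | rfl
      · refine memA ?_ (Or.inr ?_) <;> simp only [hXaff, hYaff]
        · ring
        · linear_combination -e0 - ρ * hq
      · refine memA ?_ (Or.inl ?_) <;> simp only [hXaff, hYaff]
        · linear_combination ρ ^ 3 * hω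
        · linear_combination -e0 - ρ * hq
    · change b ∈ intercepts (column S a 1) s (a 1) at hb
      change automorphism g (affinePoint (a 1) (b + s * a 1)) ∈ hessePoints
      rw [h1] at hb
      rcases hb with rfl | rfl
      · refine memA ?_ (Or.inr ?_) <;> simp only [hXaff, hYaff]
        · linear_combination ρ ^ 3 * hω
        · linear_combination -e1 - ρ * hq - ρ * hω
      · refine memA ?_ (Or.inl ?_) <;> simp only [hXaff, hYaff]
        · linear_combination ρ ^ 3 * (ω ^ 3 + 1) * hω
        · linear_combination -e1 - ρ * hq - ρ * hω
    · change b ∈ intercepts (column S a 2) s (a 2) at hb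
      change automorphism g (affinePoint (a 2) (b + s * a 2)) ∈ hessePoints
      rw [h2] at hb
      rcases hb with rfl | rfl
      · refine memA ?_ (Or.inr ?_) <;> simp only [hXaff, hYaff]
        · linear_combination ρ ^ 3 * (ω ^ 3 + 1) * hω
        · linear_combination -e2 - ρ * hq - ρ * ω * hω
      · refine memA ?_ (Or.inl ?_) <;> simp only [hXaff, hYaff]
        · ring
        · linear_combination -e2 - ρ * hq

theorem ncard_automorphism_image (g : (Fin 3 → ℂ) ≃ₗ[ℂ] (Fin 3 → ℂ)) (S : Set Plane) :
    (automorphism g '' S).ncard = S.ncard :=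
  Set.ncard_image_of_injective _ (automorphism_injective g)

theorem IsSylvesterGallai.isHesseConfiguration {S : Set Plane} (hS : IsSylvesterGallai S)
    (hL : LiesOnConcurrentLines 4 S) : IsHesseConfiguration S := by
  obtain ⟨c, ℓ, hℓ, hc, hsub⟩ := hL
  obtain ⟨-, h2⟩ := hS.pencil_structure hℓ hc hsub
  obtain ⟨g, a, ha, hgc, hg⟩ := exists_automorphism_columnLines hℓ hc
  have hS' := isSylvesterGallai_image hS g
  have hsub' := image_subset_columnLines hg hsub
  obtain ⟨p, q, hpq, he⟩ := Set.ncard_eq_two.1 (h2 0)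
  have hp : p ∈ pencilPart S c (ℓ 0) := he ▸ by simp
  have hq : q ∈ pencilPart S c (ℓ 0) := he ▸ by simp
  obtain ⟨s, hs⟩ := exists_slopePoint_of_mem_pencilPart hgc hg hp
  obtain ⟨t, ht⟩ := exists_slopePoint_of_mem_pencilPart hgc hg hq
  have hst : s ≠ t := fun h => hpq (automorphism_injective g (by rw [hs, ht, h]))
  have hE (r : ℂ) (hr : slopePoint r ∈ automorphism g '' S) : r = s ∨ r = t := by
    obtain ⟨x, hx, hxr⟩ := hr
    have : x ∈ pencilPart S c (ℓ 0) := by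
      refine ⟨⟨hx, (hg 0 x).1 (hxr ▸ slopePoint_mem_columnLines a r)⟩, ?_⟩
      rintro rfl
      exact slopePoint_ne_verticalPoint _ (hxr.symm.trans hgc)
    rw [he] at this
    rcases this with rfl | rfl
    · exact Or.inl (slopePoint_injective (hxr.symm.trans hs))
    · exact Or.inr (slopePoint_injective (hxr.symm.trans ht))
  have hA (j : Fin 3) : (column (automorphism g '' S) a j).ncard = 2 := by
    rw [← h2 j.succ, ← ncard_automorphism_image g,
      ← Set.ncard_image_of_injective (column (automorphism g '' S) a j)
        (f := affinePoint (a j)) fun _ _ h => (affinePoint_inj.1 h).2]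
    congr 1
    ext x
    constructor
    · rintro ⟨y, ⟨z, hz, hzy⟩, rfl⟩
      refine ⟨z, ⟨⟨hz, (hg _ z).1 (hzy ▸ affinePoint_mem_columnLines a j y)⟩, ?_⟩, hzy⟩
      rintro rfl
      exact affinePoint_ne_verticalPoint _ _ (hzy.symm.trans hgc)
    · rintro ⟨z, hz, rfl⟩
      obtain ⟨y, hy⟩ := exists_affinePoint_of_mem_pencilPart hgc hg hz
      exact ⟨y, ⟨z, hz.1.1, hy⟩, hy.symm⟩
  obtain ⟨u, v, w, κ, huv, hvw, hwu, h, i0, i1, i2, e0, e1, e2⟩ := hS'.exists_equilateral hsub' ha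
    hst (hs ▸ ⟨p, hp.1.1, rfl⟩) (ht ▸ ⟨q, hq.1.1, rfl⟩) hE hA
  obtain ⟨g', hg'⟩ := exists_automorphism_mem_hessePoints hsub' hst hE huv h i0 i1 i2 e0 e1 e2
  have himage : automorphism g' '' (automorphism g '' S) = hessePoints := by
    refine Set.eq_of_subset_of_ncard_le ?_ ?_ finite_hessePoints
    · rintro _ ⟨x, hx, rfl⟩
      exact hg' x hx
    · rw [ncard_automorphism_image, ncard_automorphism_image, ncard_hessePoints,
        hS.ncard_eq_nine hℓ hc hsub]
  refine ⟨(g.trans g').symm, ?_⟩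
  change S = automorphism (g.trans g').symm '' hessePoints
  have hcomp (x : Plane) : automorphism g' (automorphism g x) = automorphism (g.trans g') x := by
    induction x using Projectivization.ind with | h x hx => rfl
  rw [← himage, Set.image_image, Set.image_image]
  simp only [hcomp, automorphism_symm_apply, Set.image_id']

end SylvesterGallai


theorem corollary3 (S : Set SylvesterGallai.Plane) :
    ((SylvesterGallai.IsSylvesterGallai S ∧ SylvesterGallai.LiesOnConcurrentLines 4 S) ↔
      SylvesterGallai.IsHesseConfiguration S) ∧
    (SylvesterGallai.IsHesseConfiguration S → S.ncard = 9) := by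
  refine ⟨⟨fun ⟨hS, hL⟩ => hS.isHesseConfiguration hL, ?_⟩, ?_⟩
  · rintro ⟨g, rfl⟩
    exact ⟨SylvesterGallai.isSylvesterGallai_image
        SylvesterGallai.isSylvesterGallai_hessePoints g,
      SylvesterGallai.liesOnConcurrentLines_image
        SylvesterGallai.liesOnConcurrentLines_hessePoints g⟩
  · rintro ⟨g, rfl⟩
    rw [← SylvesterGallai.ncard_hessePoints]
    exact SylvesterGallai.ncard_automorphism_image g _
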